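/- Let $s\ge 2$ be an integer and put $\sigma=\frac{\sqrt s}{2\sqrt s+1}$. Consider a chain of $n$ spins at sites $1,\dots,n$, each with orthonormal basis states labelled by $-s,\dots,s$; a product basis state is read as a walk of $n$ steps starting at height $0$, where the label $k>0$ is an up step ($+1$) of colour $k$, the label $-k<0$ is a down step ($-1$) of colour $k$, and $0$ is a flat step. An $s$-coloured Motzkin walk of length $n$ is such a walk that never goes below height $0$, ends at height $0$, and in which every up step is matched with a down step of the same colour, the match of an up step being the first later step that returns to the height from which the up step started. Let $|\psi_n\rangle$ be the Motzkin ground state, the normalized equal superposition of all $s$-coloured Motzkin walks of length $n$, let $S^z_i$ be the operator that multiplies a product basis state by its label at site $i$, and write $\langle S^z_iS^z_j\rangle_n=\langle\psi_n|S^z_iS^z_j|\psi_n\rangle$. Then there are a function $g:\mathbb N\to\mathbb R$ and a constant $C$, both depending only on $s$, such that: 1. for all integers $L\ge 1$, $$\left|\,g(L)+\frac1{24}\sqrt{\frac{\sigma}{\pi}}\,(s^2-1)\,L^{-3/2}\right|\le C\,L^{-5/2};$$ 2. for all integers $L\ge 1$ and $n\ge L^2$ with $i=\lfloor (n-L)/2\rfloor\ge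 1$ and $j=\lfloor (n+L)/2\rfloor=i+L$, $$\bigl|\langle S^z_iS^z_j\rangle_n-g(L)\bigr|\le \frac{C}{n}.$$ In other words, uniformly for $L^2\le n$, the correlation of two spins at distance $L$ around the centre of the chain is $\langle S^z_{(n-L)/2}S^z_{(n+L)/2}\rangle=g(L)+O(n^{-1})$, where the thermodynamic limit $g(L)$ has the asymptotic expression $g(L)=-\frac1{24}\sqrt{\sigma/\pi}\,(s^2-1)\,L^{-3/2}+O(L^{-5/2})$ in $L$. -/

import Mathlib

/-- The local basis labels `-s, …, s` of a spin of size `s`. The label `k > 0` is an up step of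
colour `k`, the label `-k < 0` is a down step of colour `k`, and `0` is a flat step. -/
abbrev Spin (s : ℕ) : Type := {k : ℤ // k ∈ Finset.Icc (-(s : ℤ)) (s : ℤ)}

/-- The product basis states of a chain of `n` spins, equivalently the walks of `n` steps.
The sites `1, …, n` of the chain are represented by the elements `0, …, n - 1` of `Fin n`. -/
abbrev Walk (s n : ℕ) : Type := Fin n → Spin s

/-- The height of the walk after its first `x` steps. -/
def height {s n : ℕ} (w : Walk s n) (x : ℕ) : ℤ :=
  ∑ k : Fin n, if (k : ℕ) < x then (w k : ℤ).sign else 0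

/-- Step `a` is an up step and step `c` is the step that closes it: `c` is the first step
after `a` that brings the walk back to the height from which step `a` started. -/
def Matches {s n : ℕ} (w : Walk s n) (a c : Fin n) : Prop :=
  a < c ∧ 0 < (w a : ℤ) ∧ height w ((c : ℕ) + 1) = height w (a : ℕ) ∧
    ∀ x : ℕ, (a : ℕ) < x → x ≤ (c : ℕ) → height w (a : ℕ) < height w x

/-- The `s`-coloured Motzkin walks of `n` steps: never below the axis, back on the axis at the
end, and every up step is closed by a down step of the same colour. -/
def IsMotzkin {s n : ℕ} (w : Walk s n) : Prop :=
  (∀ x : ℕ, x ≤ n → 0 ≤ height w x) ∧ height w n = 0 ∧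
    ∀ a c : Fin n, Matches w a c → (w c : ℤ) = -(w a : ℤ)

open Classical in
/-- The finite set of all `s`-coloured Motzkin walks of `n` steps. -/
noncomputable def motzkinWalks (s n : ℕ) : Finset (Walk s n) :=
  Finset.univ.filter fun w => IsMotzkin w

/-- The Hilbert space of a chain of `n` spins of size `s`, in the orthonormal product basis. -/
abbrev ChainSpace (s n : ℕ) : Type := EuclideanSpace ℂ (Walk s n)

/-- The Motzkin ground state: the normalized equal superposition of all Motzkin walks. -/
noncomputable def groundState (s n : ℕ) : ChainSpace s n :=
  (((Real.sqrt ((motzkinWalks s n).card : ℝ))⁻¹ : ℝ) : ℂ) •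
    ∑ w ∈ motzkinWalks s n, EuclideanSpace.single w (1 : ℂ)

/-- The operator `S^z` of the spin at site `i`: it multiplies the basis state `w` by `w i`. -/
noncomputable def spinZ {s n : ℕ} (i : Fin n) : ChainSpace s n →ₗ[ℂ] ChainSpace s n :=
  Matrix.toEuclideanLin (Matrix.diagonal fun w : Walk s n => (((w i : ℤ) : ℂ)))

/-- The ground state expectation value of `S^z_i S^z_j`. -/
noncomputable def corrZZ (s n : ℕ) (i j : Fin n) : ℂ :=
  inner ℂ (groundState s n) (spinZ i (spinZ j (groundState s n)))

/-- The constant `σ = √s / (2 √s + 1)`. -/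
noncomputable def sigmaConst (s : ℕ) : ℝ :=
  Real.sqrt (s : ℝ) / (2 * Real.sqrt (s : ℝ) + 1)

/-! The correlation is a ratio of two sums over Motzkin walks. Both are computed by transfer
operators acting on functions of the stack of colours of the open up steps
(`completionSum_eq_stackChain`). A colour enters a weight only through its up step and the step that
closes it. For an unmarked up step the weight is therefore affine in the colour, so averaging over
colours amounts to inserting the mean colour, and only the height remains. The exception is a walk
whose two marked sites are matched with each other: the product -c² brings in the variance (s² -
1)/12 of the colour.

Conjugation by powers of √s turns the height operator into 2√s + 1 times the symmetric transition
operator A of a walk killed below 0. Let δ be the indicator of height 0, p_n = ⟨δ, A^n δ⟩, and D the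
difference of the two shifts. With i, k, m sites before, between and after the marked ones,
`stackChain_two_marks_nil` makes the correlation equal to (μ ⟨δ, A^i D A^k D A^m δ⟩ - γ p_k p_{i+m})
/ p_n, where μ = (mean colour · σ)² and γ = σ² (s² - 1)/12.

Since D is antisymmetric, A is a contraction and ‖D f‖² ≤ (4/σ) ⟨f, (1 - A) f⟩, the first term is
controlled by p_{2i} - p_{2i+1} and p_{2m} - p_{2m+1}, both O(n^(-5/2))
(`abs_direction_correlation_le`). In the second, replacing p_{i+m} by p_n costs p_k (k + 2)
O(n^(-5/2)), and (k + 1) p_k is bounded (`abs_returnProb_ratio_le`). As p_n has order n^(-3/2),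
division leaves O(1/n) errors around g(L) = -γ p_{L-1}. The asymptotics and decrements of p_n come
from its spectral integral, which near the edge is a Beta integral (`exists_abs_returnProb_sub_le`).
-/

/-! ### Motzkin walks decomposed by their first step. -/

lemma height_zero {s n : ℕ} (w : Walk s n) : height w 0 = 0 := by simp [height]

lemma height_cons_succ {s n : ℕ} (a : Spin s) (w : Walk s n) (x : ℕ) :
    height (Fin.cons a w : Walk s (n + 1)) (x + 1) = (a : ℤ).sign + height w x := by
  simp [height, Fin.sum_univ_succ]

/-- Step `c` is the first step that brings the walk to the height `t`, coming from above. -/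
def FirstHits {s n : ℕ} (w : Walk s n) (t : ℤ) (c : Fin n) : Prop :=
  height w ((c : ℕ) + 1) = t ∧ ∀ x : ℕ, x ≤ (c : ℕ) → t < height w x

lemma firstHits_cons_zero {s n : ℕ} (a : Spin s) (w : Walk s n) (t : ℤ) :
    FirstHits (Fin.cons a w : Walk s (n + 1)) t 0 ↔ (a : ℤ).sign = t ∧ t < 0 := by
  have h := height_cons_succ a w 0
  simp only [zero_add, height_zero, add_zero] at h
  simp [FirstHits, h, height_zero]

lemma firstHits_cons_succ {s n : ℕ} (a : Spin s) (w : Walk s n) (t : ℤ) (c : Fin n) :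
    FirstHits (Fin.cons a w : Walk s (n + 1)) t c.succ ↔
      t < 0 ∧ FirstHits w (t - (a : ℤ).sign) c := by
  simp only [FirstHits, Fin.val_succ, height_cons_succ]
  constructor
  · rintro ⟨h1, h2⟩
    refine ⟨by simpa [height_zero] using h2 0 (by omega), by omega, fun x hx => ?_⟩
    have := h2 (x + 1) (by omega)
    rw [height_cons_succ] at this
    omega
  · rintro ⟨h0, h1, h2⟩
    refine ⟨by omega, fun x hx => ?_⟩
    rcases x with _ | x
    · simpa [height_zero] using h0
    · have := h2 x (by omega)
      rw [height_cons_succ]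
      omega

lemma matches_cons_zero_succ {s n : ℕ} (a : Spin s) (w : Walk s n) (q : Fin n) :
    Matches (Fin.cons a w : Walk s (n + 1)) 0 q.succ ↔ 0 < (a : ℤ) ∧ FirstHits w (-1) q := by
  simp only [Matches, FirstHits, Fin.succ_pos, true_and, Fin.cons_zero, Fin.val_zero,
    Fin.val_succ, height_zero, height_cons_succ]
  refine and_congr_right fun ha => ?_
  rw [Int.sign_eq_one_of_pos ha]
  refine and_congr (by omega) ⟨fun h x hx => ?_, fun h x hx0 hx => ?_⟩
  · have := h (x + 1) (by omega) (by omega)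
    rw [height_cons_succ, Int.sign_eq_one_of_pos ha] at this
    omega
  · obtain ⟨y, rfl⟩ : ∃ y, x = y + 1 := ⟨x - 1, by omega⟩
    have := h y (by omega)
    rw [height_cons_succ, Int.sign_eq_one_of_pos ha]
    omega

lemma matches_cons_succ_succ {s n : ℕ} (a : Spin s) (w : Walk s n) (p q : Fin n) :
    Matches (Fin.cons a w : Walk s (n + 1)) p.succ q.succ ↔ Matches w p q := by
  simp only [Matches, Fin.succ_lt_succ_iff, Fin.cons_succ, Fin.val_succ, height_cons_succ]
  refine and_congr_right fun _ => and_congr_right fun _ =>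
    and_congr (by omega) ⟨fun h x hx0 hx => ?_, fun h x hx0 hx => ?_⟩
  · have := h (x + 1) (by omega) (by omega)
    rw [height_cons_succ] at this
    omega
  · obtain ⟨y, rfl⟩ : ∃ y, x = y + 1 := ⟨x - 1, by omega⟩
    have := h y (by omega) (by omega)
    rw [height_cons_succ]
    omega

/-- The walk `w` completes a Motzkin walk whose still open up steps have the colours listed in
`st`, the most recent one first. -/
def MotzkinFrom {s n : ℕ} (st : List ℤ) (w : Walk s n) : Prop :=
  (∀ x : ℕ, x ≤ n → 0 ≤ (st.length : ℤ) + height w x) ∧ (st.length : ℤ) + height w n = 0 ∧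
    (∀ a c : Fin n, Matches w a c → (w c : ℤ) = -(w a : ℤ)) ∧
    ∀ (d : ℕ) (e : ℤ), st[d]? = some e → ∀ c : Fin n, FirstHits w (-(d + 1)) c → (w c : ℤ) = -e

lemma isMotzkin_iff_motzkinFrom_nil {s n : ℕ} (w : Walk s n) :
    IsMotzkin w ↔ MotzkinFrom [] w := by
  simp [IsMotzkin, MotzkinFrom]

lemma motzkinFrom_zero_iff {s : ℕ} (st : List ℤ) (w : Walk s 0) :
    MotzkinFrom st w ↔ st = [] := by
  constructor
  · rintro ⟨-, h, -⟩
    simpa [height_zero] using h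
  · rintro rfl
    refine ⟨fun x hx => ?_, ?_, fun a => a.elim0, by simp⟩ <;> simp [height]

lemma forall_le_height_cons {s n : ℕ} (a : Spin s) (w : Walk s n) (l : ℕ) :
    (∀ x : ℕ, x ≤ n + 1 → 0 ≤ (l : ℤ) + height (Fin.cons a w : Walk s (n + 1)) x) ↔
      ∀ x : ℕ, x ≤ n → 0 ≤ (l : ℤ) + (a : ℤ).sign + height w x := by
  constructor
  · intro h x hx
    have := h (x + 1) (by omega)
    rw [height_cons_succ] at this
    omega
  · intro h x hx
    rcases x with _ | x
    · simp [height_zero]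
    · have := h x (by omega)
      rw [height_cons_succ]
      omega

lemma forall_matches_cons {s n : ℕ} (a : Spin s) (w : Walk s n) :
    (∀ p q : Fin (n + 1), Matches (Fin.cons a w : Walk s (n + 1)) p q →
        (((Fin.cons a w : Walk s (n + 1)) q : Spin s) : ℤ) =
          -(((Fin.cons a w : Walk s (n + 1)) p : Spin s) : ℤ)) ↔
      (0 < (a : ℤ) → ∀ q, FirstHits w (-1) q → (w q : ℤ) = -(a : ℤ)) ∧
        ∀ p q : Fin n, Matches w p q → (w q : ℤ) = -(w p : ℤ) := by
  have h0 : ∀ p, ¬ Matches (Fin.cons a w : Walk s (n + 1)) p 0 := fun p h => by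
    simpa using h.1
  simp only [Fin.forall_fin_succ, h0, matches_cons_zero_succ, matches_cons_succ_succ,
    Fin.cons_zero, Fin.cons_succ, false_imp_iff, true_and, and_imp]
  tauto

/-- The step closing the new up step is the first one where the rest of the walk hits level -1. The
matching condition at the first site thus becomes the condition on the top of the stack, and the
older entries move down by one. -/
lemma motzkinFrom_cons_of_pos {s n : ℕ} (st : List ℤ) (a : Spin s) (w : Walk s n)
    (ha : 0 < (a : ℤ)) :
    MotzkinFrom st (Fin.cons a w : Walk s (n + 1)) ↔ MotzkinFrom ((a : ℤ) :: st) w := by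
  have hs := Int.sign_eq_one_of_pos ha
  simp only [MotzkinFrom, forall_le_height_cons, forall_matches_cons]
  simp only [height_cons_succ, hs, List.length_cons, Fin.forall_fin_succ, firstHits_cons_zero, firstHits_cons_succ,
    Fin.cons_zero, Fin.cons_succ, Nat.cast_add, Nat.cast_one, ha, true_imp_iff]
  constructor
  · rintro ⟨h1, h2, ⟨h3, h4⟩, h5⟩
    refine ⟨h1, by omega, h4, fun d e hd c hc => ?_⟩
    rcases d with _ | d
    · simp only [List.getElem?_cons_zero, Option.some.injEq] at hd
      subst hd
      exact h3 c (by simpa using hc)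
    · refine (h5 d e (by simpa using hd)).2 c ⟨by omega, ?_⟩
      convert hc using 1
      push_cast
      ring
  · rintro ⟨h1, h2, h4, h5⟩
    refine ⟨h1, by omega, ⟨fun q hq => h5 0 _ (by simp) q (by simpa using hq), h4⟩,
      fun d e hd => ⟨fun h => by omega, fun c hc => h5 (d + 1) e (by simpa using hd) c ?_⟩⟩
    convert hc.2 using 1
    push_cast
    ring

lemma motzkinFrom_cons_of_eq_zero {s n : ℕ} (st : List ℤ) (a : Spin s) (w : Walk s n)
    (ha : (a : ℤ) = 0) :
    MotzkinFrom st (Fin.cons a w : Walk s (n + 1)) ↔ MotzkinFrom st w := by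
  have h' : ∀ d : ℕ, ¬ (0 : ℤ) = -((d : ℤ) + 1) := fun d => by omega
  simp only [MotzkinFrom, forall_le_height_cons, forall_matches_cons]
  simp [height_cons_succ, ha, h', Fin.forall_fin_succ, firstHits_cons_zero,
    firstHits_cons_succ, -neg_add_rev]

/-- The down step hits level -1 at once, so it closes the top entry and must carry its colour; on an
empty stack it would go below the axis. -/
lemma motzkinFrom_cons_of_neg {s n : ℕ} (st : List ℤ) (a : Spin s) (w : Walk s n)
    (ha : (a : ℤ) < 0) :
    MotzkinFrom st (Fin.cons a w : Walk s (n + 1)) ↔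
      ∃ tl, st = (-(a : ℤ)) :: tl ∧ MotzkinFrom tl w := by
  have hs := Int.sign_eq_neg_one_of_neg ha
  have ha' : ¬ 0 < (a : ℤ) := by omega
  rcases st with _ | ⟨e, tl⟩
  · simp only [reduceCtorEq, false_and, exists_false, iff_false]
    rintro ⟨h, -⟩
    have := h 1 (by omega)
    have h1 := height_cons_succ a w 0
    simp only [zero_add] at h1
    rw [h1, hs, height_zero] at this
    simp at this
  simp only [MotzkinFrom, forall_le_height_cons, forall_matches_cons]
  simp only [height_cons_succ, hs, List.length_cons, Fin.forall_fin_succ, firstHits_cons_zero, firstHits_cons_succ,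
    Fin.cons_zero, Fin.cons_succ, Nat.cast_add, Nat.cast_one, ha', false_imp_iff, true_and,
    List.cons.injEq]
  constructor
  · rintro ⟨h1, h2, h4, h5⟩
    have he := (h5 0 e (by simp)).1 (by simp)
    refine ⟨tl, ⟨by omega, rfl⟩, fun x hx => by have := h1 x hx; omega, by omega, h4,
      fun d e' hd c hc => (h5 (d + 1) e' (by simpa using hd)).2 c ⟨by omega, ?_⟩⟩
    convert hc using 1
    push_cast
    ring
  · rintro ⟨_, ⟨rfl, rfl⟩, h1, h2, h4, h5⟩
    refine ⟨fun x hx => by have := h1 x hx; omega, by omega, h4, fun d e' hd => ?_⟩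
    rcases d with _ | d
    · simp only [List.getElem?_cons_zero, Option.some.injEq] at hd
      subst hd
      refine ⟨fun _ => by simp, fun c hc => ?_⟩
      have := hc.2.2 0 (by omega)
      simp [height_zero] at this
    · refine ⟨fun h => by push_cast at h; omega,
        fun c hc => h5 d e' (by simpa using hd) c ?_⟩
      convert hc.2 using 1
      push_cast
      ring

/-! ### Transfer operators on stacks of colours, and averaging over the colours. -/

section

open Finset

/-- The weight of a step with label `x`: the label itself at a marked site, `1` elsewhere. -/
def stepWeight (b : Bool) (x : ℝ) : ℝ := if b then x else 1

/-- The contribution of the down step that closes the most recent open up step. -/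
def popTerm (b : Bool) (Φ : List ℝ → ℝ) : List ℝ → ℝ
  | [] => 0
  | e :: tl => stepWeight b (-e) * Φ tl

/-- The transfer operator of one step on functions of the list of colours of the open up steps. -/
noncomputable def stackStep (s : ℕ) (b : Bool) (Φ : List ℝ → ℝ) (st : List ℝ) : ℝ :=
  stepWeight b 0 * Φ st +
    ∑ c ∈ range s, stepWeight b (c + 1) * Φ (((c : ℝ) + 1) :: st) + popTerm b Φ st

/-- The indicator function of the empty list. -/
def emptyStack : List ℝ → ℝ
  | [] => 1
  | _ :: _ => 0

/-- The product of the transfer operators of `n` steps, with the sites `k` with `b k` marked. -/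
noncomputable def stackChain (s : ℕ) : ℕ → (ℕ → Bool) → List ℝ → ℝ
  | 0, _ => emptyStack
  | n + 1, b => stackStep s (b 0) (stackChain s n fun k => b (k + 1))

open Classical in
/-- The sum over all completions of the open up steps `st`, each weighted by its labels at the
marked sites. -/
noncomputable def completionSum (s n : ℕ) (b : ℕ → Bool) (st : List ℤ) : ℝ :=
  ∑ w : Walk s n, if MotzkinFrom st w then ∏ k : Fin n, stepWeight (b k) ((w k : ℤ) : ℝ) else 0

lemma sum_Icc_neg_self (s : ℕ) (G : ℤ → ℝ) :
    ∑ x ∈ Icc (-(s : ℤ)) s, G x =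
      G 0 + ∑ c ∈ range s, G ((c : ℤ) + 1) + ∑ c ∈ range s, G (-((c : ℤ) + 1)) := by
  induction s with
  | zero => simp
  | succ s ih =>
    have h : Icc (-((s + 1 : ℕ) : ℤ)) ((s + 1 : ℕ) : ℤ) =
        insert ((s : ℤ) + 1) (insert (-((s : ℤ) + 1)) (Icc (-(s : ℤ)) s)) := by
      ext x
      simp only [mem_Icc, mem_insert]
      push_cast
      omega
    rw [h, sum_insert, sum_insert, ih, sum_range_succ, sum_range_succ]
    · ring
    · simp
    · simp only [mem_insert, mem_Icc, not_or]
      omega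

lemma sum_spin (s : ℕ) (G : ℤ → ℝ) :
    ∑ a : Spin s, G a =
      G 0 + ∑ c ∈ range s, G ((c : ℤ) + 1) + ∑ c ∈ range s, G (-((c : ℤ) + 1)) := by
  rw [← sum_Icc_neg_self]
  exact Finset.sum_coe_sort (Icc (-(s : ℤ)) s) G

lemma sum_walk_succ {s n : ℕ} (F : Walk s (n + 1) → ℝ) :
    ∑ w, F w = ∑ a : Spin s, ∑ w : Walk s n, F (Fin.cons a w : Walk s (n + 1)) := by
  rw [← Fintype.sum_prod_type', ← (Fin.consEquiv fun _ : Fin (n + 1) => Spin s).sum_comp]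
  rfl

/-- The first step is split off. The bounds on the entries ensure that the down step popping the top
colour is an admissible label. The stacks are real lists on the right so that the mean colour,
possibly a half-integer, may later be inserted. -/
lemma completionSum_eq_stackChain (s n : ℕ) (b : ℕ → Bool) (st : List ℤ)
    (hst : ∀ e ∈ st, 1 ≤ e ∧ e ≤ s) :
    completionSum s n b st = stackChain s n b (st.map (Int.cast : ℤ → ℝ)) := by
  classical
  induction n generalizing b st with
  | zero =>
    rw [completionSum, Fintype.sum_unique, motzkinFrom_zero_iff]
    rcases st with _ | ⟨e, tl⟩ <;> simp [stackChain, emptyStack]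
  | succ n ih =>
    set b' : ℕ → Bool := fun k => b (k + 1)
    let G : ℤ → ℝ := fun x => stepWeight (b 0) x *
      if 0 < x then completionSum s n b' (x :: st) else
        if x = 0 then completionSum s n b' st else
          if st.head? = some (-x) then completionSum s n b' st.tail else 0
    have key : ∀ a : Spin s, (∑ w : Walk s n,
        if MotzkinFrom st (Fin.cons a w : Walk s (n + 1)) then
          ∏ k : Fin (n + 1), stepWeight (b k)
            ((((Fin.cons a w : Walk s (n + 1)) k : Spin s) : ℤ) : ℝ) else 0) =
        G a := by
      intro a
      simp only [G]
      simp only [Fin.prod_univ_succ, Fin.cons_zero, Fin.cons_succ, Fin.val_zero, Fin.val_succ]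
      rcases lt_trichotomy (a : ℤ) 0 with ha | ha | ha
      · simp only [motzkinFrom_cons_of_neg st a _ ha, not_lt.2 ha.le, ha.ne, if_false]
        rcases st with _ | ⟨e, tl⟩
        · simp
        · by_cases he : e = -(a : ℤ)
          · simp only [he, List.cons.injEq, true_and, exists_eq_left', List.head?_cons, if_true,
              List.tail_cons, completionSum, mul_sum, mul_ite, mul_zero]
            rfl
          · simp [he]
      · simp only [motzkinFrom_cons_of_eq_zero st a _ ha, completionSum, mul_sum, mul_ite, mul_zero,
          ha, lt_irrefl, if_false, if_true]
        rfl
      · simp only [motzkinFrom_cons_of_pos st a _ ha, completionSum, mul_sum, mul_ite, mul_zero,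
          ha, if_true]
        rfl
    rw [completionSum, sum_walk_succ, sum_congr rfl fun a _ => key a, sum_spin s G, stackChain,
      stackStep]
    simp only [G]
    congr 1
    · congr 1
      · simp [ih b' st hst, b']
      · refine sum_congr rfl fun c hc => ?_
        have hc' := mem_range.1 hc
        have := ih b' (((c : ℤ) + 1) :: st) (by
          intro e he
          rcases List.mem_cons.1 he with rfl | he
          · omega
          · exact hst e he)
        have hpos : (0 : ℤ) < (c : ℤ) + 1 := by omega
        simp only [hpos, if_true, this]
        simp [b']
    · have hneg : ∀ c : ℕ, ¬ (0 : ℤ) < -((c : ℤ) + 1) := fun c => by omega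
      have hne : ∀ c : ℕ, ¬ -((c : ℤ) + 1) = 0 := fun c => by omega
      simp only [hneg, hne, if_false, neg_neg]
      rcases st with _ | ⟨e, tl⟩
      · simp [popTerm]
      · obtain ⟨h1, h2⟩ := hst e (by simp)
        obtain ⟨d, rfl⟩ : ∃ d : ℕ, e = d + 1 := ⟨(e - 1).toNat, by omega⟩
        rw [sum_eq_single d]
        · have := ih b' tl fun e he => hst e (by simp [he])
          simp [popTerm, this, b']
        · intro c _ hcd
          have : ¬ (d : ℤ) = c := by omega
          simp [this]
        · intro h
          simp only [mem_range] at h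
          omega

/-- A function of a list of reals that is affine in each entry. -/
def SlotAffine (Φ : List ℝ → ℝ) : Prop :=
  ∀ pre post : List ℝ, ∃ a b : ℝ, ∀ c : ℝ, Φ (pre ++ c :: post) = a + b * c

lemma slotAffine_emptyStack : SlotAffine emptyStack := fun pre post =>
  ⟨0, 0, fun c => by cases pre <;> simp [emptyStack]⟩

/-- An entry either stays on the stack or is popped. If it is popped, it contributes a factor affine
in it, times a value on a tail that no longer contains it, so no square arises. -/
lemma SlotAffine.stackStep {Φ : List ℝ → ℝ} (h : SlotAffine Φ) (s : ℕ) (b : Bool) :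
    SlotAffine (stackStep s b Φ) := by
  intro pre post
  obtain ⟨a₀, b₀, h₀⟩ := h pre post
  choose a₁ b₁ h₁ using fun c' : ℝ => h (c' :: pre) post
  obtain ⟨a₂, b₂, h₂⟩ : ∃ x y : ℝ, ∀ c, popTerm b Φ (pre ++ c :: post) = x + y * c := by
    rcases pre with _ | ⟨p, pre⟩
    · cases b
      · exact ⟨Φ post, 0, fun c => by simp [popTerm, stepWeight]⟩
      · exact ⟨0, -Φ post, fun c => by simp [popTerm, stepWeight]; ring⟩
    · obtain ⟨x, y, hxy⟩ := h pre post
      exact ⟨stepWeight b (-p) * x, stepWeight b (-p) * y, fun c => by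
        simp only [List.cons_append, popTerm, hxy]
        ring⟩
  refine ⟨stepWeight b 0 * a₀ + ∑ c ∈ range s, stepWeight b (c + 1) * a₁ (c + 1) + a₂,
    stepWeight b 0 * b₀ + ∑ c ∈ range s, stepWeight b (c + 1) * b₁ (c + 1) + b₂, fun c => ?_⟩
  simp only [_root_.stackStep, h₀, h₂, ← List.cons_append, h₁, mul_add, sum_add_distrib, add_mul,
    sum_mul, mul_assoc]
  ring

lemma slotAffine_stackChain (s n : ℕ) (b : ℕ → Bool) : SlotAffine (stackChain s n b) := by
  induction n generalizing b with
  | zero => exact slotAffine_emptyStack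
  | succ n ih => exact (ih _).stackStep s _

/-- The shift of a sequence to the left. -/
def shiftLeft (f : ℕ → ℝ) (h : ℕ) : ℝ := f (h + 1)

/-- The shift of a sequence to the right, with `0` as the new first term. -/
def shiftRight (f : ℕ → ℝ) : ℕ → ℝ
  | 0 => 0
  | h + 1 => f h

/-- The transfer operator of an unmarked step on functions of the height. -/
def heightStep (s : ℕ) (f : ℕ → ℝ) (h : ℕ) : ℝ := f h + s * shiftLeft f h + shiftRight f h

/-- The average colour. -/
noncomputable def meanColour (s : ℕ) : ℝ := ((s : ℝ) + 1) / 2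

/-- The indicator function of the height `0`. -/
def zeroHeight : ℕ → ℝ
  | 0 => 1
  | _ + 1 => 0

/-- The restriction of a function of the colours to lists whose entries are the average colour. -/
noncomputable def meanField (s : ℕ) (Φ : List ℝ → ℝ) (h : ℕ) : ℝ :=
  Φ (List.replicate h (meanColour s))

lemma sum_range_colour (s : ℕ) : ∑ c ∈ range s, ((c : ℝ) + 1) = s * meanColour s := by
  induction s with
  | zero => simp
  | succ s ih =>
    rw [sum_range_succ, ih, meanColour, meanColour]
    push_cast
    ring

/-- The last term is s times the variance of a uniform colour, the source of the factor s² - 1 in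
the theorem. -/
lemma sum_range_colour_sq (s : ℕ) : ∑ c ∈ range s, ((c : ℝ) + 1) ^ 2 =
    s * meanColour s ^ 2 + s * ((s : ℝ) ^ 2 - 1) / 12 := by
  induction s with
  | zero => simp
  | succ s ih =>
    rw [sum_range_succ, ih, meanColour, meanColour]
    push_cast
    ring

lemma meanField_emptyStack (s : ℕ) : meanField s emptyStack = zeroHeight := by
  funext h
  cases h <;> simp [meanField, emptyStack, zeroHeight, List.replicate_succ]

/-- The mean of an affine function over the colours is its value at the mean colour. -/
lemma meanField_stackStep_false {Φ : List ℝ → ℝ} (hΦ : SlotAffine Φ) (s : ℕ) :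
    meanField s (stackStep s false Φ) = heightStep s (meanField s Φ) := by
  funext h
  obtain ⟨a, b, hab⟩ := hΦ [] (List.replicate h (meanColour s))
  simp only [List.nil_append] at hab
  have hpop : popTerm false Φ (List.replicate h (meanColour s)) =
      shiftRight (meanField s Φ) h := by
    cases h <;> simp [popTerm, shiftRight, meanField, List.replicate_succ, stepWeight]
  have hsum : ∑ c ∈ range s, (a + b * ((c : ℝ) + 1)) = s * (a + b * meanColour s) := by
    rw [sum_add_distrib, ← mul_sum, sum_range_colour, sum_const, card_range, nsmul_eq_mul]
    ring
  have hw : ∀ x, stepWeight false x = 1 := fun x => rfl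
  simp only [meanField, shiftLeft, List.replicate_succ, stackStep, heightStep, hab, hw,
    one_mul, hsum] at hpop ⊢
  rw [hpop]

/-- A marked up step weights an affine function of its colour by the colour itself. The second
moment appears, and its variance part multiplies the slope -r. -/
lemma meanField_stackStep_true {Φ : List ℝ → ℝ} {s : ℕ} {r : ℕ → ℝ} {h : ℕ}
    (hr : ∀ c, Φ (c :: List.replicate h (meanColour s)) =
      Φ (0 :: List.replicate h (meanColour s)) - c * r h) :
    meanField s (stackStep s true Φ) h =
      meanColour s * (s * shiftLeft (meanField s Φ) h - shiftRight (meanField s Φ) h) -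
        s * ((s : ℝ) ^ 2 - 1) / 12 * r h := by
  have hpop : popTerm true Φ (List.replicate h (meanColour s)) =
      -(meanColour s * shiftRight (meanField s Φ) h) := by
    cases h <;> simp [popTerm, shiftRight, meanField, List.replicate_succ, stepWeight]
  have hsum : ∑ c ∈ range s, ((c : ℝ) + 1) * Φ (((c : ℝ) + 1) ::
      List.replicate h (meanColour s)) =
      s * meanColour s * Φ (0 :: List.replicate h (meanColour s)) -
        (s * meanColour s ^ 2 + s * ((s : ℝ) ^ 2 - 1) / 12) * r h := by
    rw [← sum_range_colour_sq, ← sum_range_colour, sum_mul, sum_mul, ← sum_sub_distrib]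
    refine sum_congr rfl fun c _ => ?_
    rw [hr]
    ring
  simp only [meanField, shiftLeft, List.replicate_succ] at hpop ⊢
  rw [stackStep, hpop]
  simp only [stepWeight, if_true, hsum]
  rw [hr (meanColour s)]
  ring

lemma meanField_iterate_stackStep {Φ : List ℝ → ℝ} (hΦ : SlotAffine Φ) (s n : ℕ) :
    meanField s ((stackStep s false)^[n] Φ) = (heightStep s)^[n] (meanField s Φ) := by
  induction n generalizing Φ with
  | zero => rfl
  | succ n ih =>
    rw [Function.iterate_succ_apply, Function.iterate_succ_apply,
      ih (hΦ.stackStep s false), meanField_stackStep_false hΦ]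

lemma iterate_stackStep_emptyStack (s n : ℕ) (st : List ℝ) :
    (stackStep s false)^[n] emptyStack st = (heightStep s)^[n] zeroHeight st.length := by
  induction n generalizing st with
  | zero => cases st <;> rfl
  | succ n ih =>
    rw [Function.iterate_succ_apply', Function.iterate_succ_apply', stackStep, heightStep]
    have hpop : popTerm false ((stackStep s false)^[n] emptyStack) st =
        shiftRight ((heightStep s)^[n] zeroHeight) st.length := by
      cases st <;> simp [popTerm, shiftRight, stepWeight, ih]
    rw [hpop]
    simp [ih, stepWeight, shiftLeft]

/-- The dependence on the colour of one open up step comes from the walks in which the marked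
site closes that step. -/
lemma iterate_stackStep_slot (s k m : ℕ) (pre post : List ℝ) (c : ℝ) :
    (stackStep s false)^[k] (stackStep s true ((stackStep s false)^[m] emptyStack))
        (pre ++ c :: post) =
      (stackStep s false)^[k] (stackStep s true ((stackStep s false)^[m] emptyStack))
        (pre ++ 0 :: post) -
        c * ((heightStep s)^[k] zeroHeight pre.length *
          (heightStep s)^[m] zeroHeight post.length) := by
  induction k generalizing pre with
  | zero =>
    -- The marked step closes the entry c only if c is on top, that is, if `pre` is empty;
    -- everything after it depends on the length of the stack alone.
    rcases pre with _ | ⟨p, pre⟩ <;>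
      simp [stackStep, popTerm, iterate_stackStep_emptyStack, zeroHeight, stepWeight,
        -Function.iterate_succ]
    ring
  | succ k ih =>
    set Ψ := (stackStep s false)^[k] (stackStep s true ((stackStep s false)^[m] emptyStack))
      with hΨ
    set F := (heightStep s)^[k] zeroHeight with hF
    set G := (heightStep s)^[m] zeroHeight post.length
    have hup : ∀ c' : ℝ, Ψ (c' :: (pre ++ c :: post)) =
        Ψ (c' :: (pre ++ 0 :: post)) - c * (F (pre.length + 1) * G) := fun c' => by
      simpa using ih (c' :: pre)
    have hpop : popTerm false Ψ (pre ++ c :: post) =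
        popTerm false Ψ (pre ++ 0 :: post) - c * (shiftRight F pre.length * G) := by
      rcases pre with _ | ⟨p, pre⟩
      · simp [popTerm, stepWeight, shiftRight]
      · simpa [popTerm, stepWeight, shiftRight] using ih pre
    rw [Function.iterate_succ_apply', Function.iterate_succ_apply', ← hΨ, ← hF, stackStep,
      stackStep, hpop, ih pre, heightStep]
    have hw : ∀ x, stepWeight false x = 1 := fun x => rfl
    simp only [hup, hw, shiftLeft, one_mul, sum_sub_distrib, sum_const, card_range, nsmul_eq_mul]
    ring

end

/-! ### The killed walk as a symmetric contraction. -/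

section

open Finset

/-- Sequences that vanish from some index on. -/
def FinitelySupported (f : ℕ → ℝ) : Prop := ∃ N, ∀ h, N ≤ h → f h = 0

namespace FinitelySupported

variable {f g : ℕ → ℝ}

lemma add (hf : FinitelySupported f) (hg : FinitelySupported g) : FinitelySupported (f + g) := by
  obtain ⟨N, hN⟩ := hf
  obtain ⟨N', hN'⟩ := hg
  exact ⟨max N N', fun h hh => by
    simp [hN h (le_trans (le_max_left _ _) hh), hN' h (le_trans (le_max_right _ _) hh)]⟩

lemma smul (hf : FinitelySupported f) (c : ℝ) : FinitelySupported (c • f) := by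
  obtain ⟨N, hN⟩ := hf
  exact ⟨N, fun h hh => by simp [hN h hh]⟩

lemma shiftLeft (hf : FinitelySupported f) : FinitelySupported (shiftLeft f) := by
  obtain ⟨N, hN⟩ := hf
  exact ⟨N, fun h hh => hN _ (by omega)⟩

lemma shiftRight (hf : FinitelySupported f) : FinitelySupported (shiftRight f) := by
  obtain ⟨N, hN⟩ := hf
  refine ⟨N + 1, fun h hh => ?_⟩
  obtain ⟨h, rfl⟩ : ∃ y, h = y + 1 := ⟨h - 1, by omega⟩
  exact hN _ (by omega)

lemma summable_mul (hf : FinitelySupported f) (g : ℕ → ℝ) : Summable fun h => f h * g h := by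
  obtain ⟨N, hN⟩ := hf
  refine summable_of_ne_finset_zero (s := range N) fun h hh => ?_
  rw [hN h (by simpa using hh), zero_mul]

end FinitelySupported

lemma finitelySupported_zeroHeight : FinitelySupported zeroHeight :=
  ⟨1, fun h hh => by obtain ⟨h, rfl⟩ : ∃ y, h = y + 1 := ⟨h - 1, by omega⟩; rfl⟩

/-- The pairing of sequences. -/
noncomputable def pairing (f g : ℕ → ℝ) : ℝ := ∑' h, f h * g h

lemma pairing_comm (f g : ℕ → ℝ) : pairing f g = pairing g f :=
  tsum_congr fun _ => mul_comm _ _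

lemma pairing_add_left {f₁ f₂ : ℕ → ℝ} (h₁ : FinitelySupported f₁) (h₂ : FinitelySupported f₂)
    (g : ℕ → ℝ) : pairing (f₁ + f₂) g = pairing f₁ g + pairing f₂ g := by
  rw [pairing, pairing, pairing, ← (h₁.summable_mul g).tsum_add (h₂.summable_mul g)]
  exact tsum_congr fun h => add_mul _ _ _

lemma pairing_smul_left (c : ℝ) (f g : ℕ → ℝ) : pairing (c • f) g = c * pairing f g := by
  rw [pairing, pairing, ← tsum_mul_left]
  exact tsum_congr fun h => mul_assoc _ _ _

lemma pairing_add_right {g₁ g₂ : ℕ → ℝ} (f : ℕ → ℝ) (h₁ : FinitelySupported g₁)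
    (h₂ : FinitelySupported g₂) : pairing f (g₁ + g₂) = pairing f g₁ + pairing f g₂ := by
  rw [pairing_comm, pairing_add_left h₁ h₂, pairing_comm g₁, pairing_comm g₂]

lemma pairing_smul_right (c : ℝ) (f g : ℕ → ℝ) : pairing f (c • g) = c * pairing f g := by
  rw [pairing_comm, pairing_smul_left, pairing_comm]

lemma pairing_self_nonneg (f : ℕ → ℝ) : 0 ≤ pairing f f :=
  tsum_nonneg fun _ => mul_self_nonneg _

lemma pairing_zeroHeight (f : ℕ → ℝ) : pairing zeroHeight f = f 0 := by
  rw [pairing, tsum_eq_single 0]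
  · simp [zeroHeight]
  · intro h hh
    obtain ⟨h, rfl⟩ : ∃ y, h = y + 1 := ⟨h - 1, by omega⟩
    simp [zeroHeight]

lemma pairing_shiftRight_left {f : ℕ → ℝ} (hf : FinitelySupported f) (g : ℕ → ℝ) :
    pairing (shiftRight f) g = pairing f (shiftLeft g) := by
  rw [pairing, (hf.shiftRight.summable_mul g).tsum_eq_zero_add]
  simp [shiftRight, pairing, shiftLeft]

lemma pairing_shiftLeft_left {g : ℕ → ℝ} (f : ℕ → ℝ) (hg : FinitelySupported g) :
    pairing (shiftLeft f) g = pairing f (shiftRight g) := by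
  rw [pairing_comm, ← pairing_shiftRight_left hg, pairing_comm]

lemma pairing_shiftRight_self {f : ℕ → ℝ} (hf : FinitelySupported f) :
    pairing (shiftRight f) (shiftRight f) = pairing f f :=
  pairing_shiftRight_left hf _

lemma pairing_shiftLeft_self_le {f : ℕ → ℝ} (hf : FinitelySupported f) :
    pairing (shiftLeft f) (shiftLeft f) ≤ pairing f f := by
  rw [pairing, pairing, (hf.summable_mul f).tsum_eq_zero_add]
  exact le_add_of_nonneg_left (mul_self_nonneg _)

lemma abs_pairing_le {f g : ℕ → ℝ} (hf : FinitelySupported f) (hg : FinitelySupported g) :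
    |pairing f g| ≤ (pairing f f + pairing g g) / 2 := by
  have h1 := pairing_self_nonneg (f + g)
  have h2 := pairing_self_nonneg (f + (-1 : ℝ) • g)
  have hg' := hg.smul (-1)
  rw [pairing_add_left hf hg, pairing_add_right _ hf hg, pairing_add_right _ hf hg,
    pairing_comm g f] at h1
  rw [pairing_add_left hf hg', pairing_add_right _ hf hg', pairing_add_right _ hf hg',
    pairing_smul_left, pairing_smul_left, pairing_smul_right, pairing_smul_right,
    pairing_comm g f] at h2
  rw [abs_le]
  constructor <;> linarith

/-- The transition operator of the walk with step probabilities `σ`, `1 - 2 σ`, `σ`, killed below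
the height `0`. -/
def killedStep (σ : ℝ) (f : ℕ → ℝ) : ℕ → ℝ :=
  (1 - 2 * σ) • f + σ • (shiftLeft f + shiftRight f)

/-- The difference of the two shifts. -/
def shiftDiff (f : ℕ → ℝ) : ℕ → ℝ := shiftLeft f + (-1 : ℝ) • shiftRight f

lemma FinitelySupported.killedStep {f : ℕ → ℝ} (hf : FinitelySupported f) (σ : ℝ) :
    FinitelySupported (killedStep σ f) :=
  (hf.smul _).add ((hf.shiftLeft.add hf.shiftRight).smul _)

lemma FinitelySupported.iterate_killedStep {f : ℕ → ℝ} (hf : FinitelySupported f) (σ : ℝ)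
    (n : ℕ) : FinitelySupported ((_root_.killedStep σ)^[n] f) := by
  induction n with
  | zero => exact hf
  | succ n ih =>
    rw [Function.iterate_succ_apply']
    exact ih.killedStep σ

lemma FinitelySupported.shiftDiff {f : ℕ → ℝ} (hf : FinitelySupported f) :
    FinitelySupported (shiftDiff f) :=
  hf.shiftLeft.add (hf.shiftRight.smul _)

lemma pairing_killedStep_right (σ : ℝ) {f g : ℕ → ℝ} (hg : FinitelySupported g) :
    pairing f (killedStep σ g) = (1 - 2 * σ) * pairing f g +
      σ * (pairing f (shiftLeft g) + pairing f (shiftRight g)) := by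
  rw [killedStep, pairing_add_right _ (hg.smul _) ((hg.shiftLeft.add hg.shiftRight).smul _),
    pairing_smul_right, pairing_smul_right, pairing_add_right _ hg.shiftLeft hg.shiftRight]

lemma pairing_killedStep_left (σ : ℝ) {f g : ℕ → ℝ} (hf : FinitelySupported f)
    (hg : FinitelySupported g) :
    pairing (killedStep σ f) g = pairing f (killedStep σ g) := by
  rw [pairing_comm, pairing_killedStep_right σ hf, pairing_killedStep_right σ hg,
    pairing_comm g (shiftLeft f), pairing_comm g (shiftRight f), pairing_shiftLeft_left f hg,
    pairing_shiftRight_left hf, pairing_comm g f]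
  ring

lemma pairing_iterate_killedStep_left (σ : ℝ) (n : ℕ) {f g : ℕ → ℝ} (hf : FinitelySupported f)
    (hg : FinitelySupported g) :
    pairing ((killedStep σ)^[n] f) g = pairing f ((killedStep σ)^[n] g) := by
  induction n generalizing g with
  | zero => rfl
  | succ n ih =>
    rw [Function.iterate_succ_apply', pairing_killedStep_left σ (hf.iterate_killedStep σ n) hg,
      ih (hg.killedStep σ), Function.iterate_succ_apply]

lemma pairing_shiftDiff_left {f g : ℕ → ℝ} (hf : FinitelySupported f)
    (hg : FinitelySupported g) :
    pairing (shiftDiff f) g = -pairing f (shiftDiff g) := by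
  rw [shiftDiff, shiftDiff, pairing_add_left hf.shiftLeft (hf.shiftRight.smul _),
    pairing_add_right _ hg.shiftLeft (hg.shiftRight.smul _), pairing_smul_left,
    pairing_smul_right, pairing_shiftLeft_left f hg, pairing_shiftRight_left hf]
  ring

/-- Pointwise this is convexity of the square for the weights 1 - 2σ, σ, σ; the shifts do not
increase the norm. -/
lemma pairing_killedStep_self_le {σ : ℝ} (h0 : 0 ≤ σ) (h1 : σ ≤ 1 / 2) {f : ℕ → ℝ}
    (hf : FinitelySupported f) :
    pairing (killedStep σ f) (killedStep σ f) ≤ pairing f f := by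
  have hpt : ∀ h, killedStep σ f h * killedStep σ f h ≤ (1 - 2 * σ) * (f h * f h) +
      σ * (shiftLeft f h * shiftLeft f h + shiftRight f h * shiftRight f h) := by
    intro h
    simp only [killedStep, Pi.add_apply, Pi.smul_apply, smul_eq_mul]
    generalize f h = x
    generalize shiftLeft f h = y
    generalize shiftRight f h = z
    nlinarith [mul_nonneg (mul_nonneg h0 (by linarith : 0 ≤ 1 - 2 * σ)) (sq_nonneg (x - y)),
      mul_nonneg (mul_nonneg h0 (by linarith : 0 ≤ 1 - 2 * σ)) (sq_nonneg (x - z)),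
      mul_nonneg (mul_nonneg h0 h0) (sq_nonneg (y - z))]
  have hsf := hf.summable_mul f
  have hsl := hf.shiftLeft.summable_mul (shiftLeft f)
  have hsr := hf.shiftRight.summable_mul (shiftRight f)
  have hle := Summable.tsum_le_tsum hpt ((hf.killedStep σ).summable_mul _)
    ((hsf.mul_left _).add ((hsl.add hsr).mul_left _))
  rw [(hsf.mul_left _).tsum_add ((hsl.add hsr).mul_left _), tsum_mul_left, tsum_mul_left,
    hsl.tsum_add hsr] at hle
  have hl := pairing_shiftLeft_self_le hf
  have hr := pairing_shiftRight_self hf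
  simp only [pairing] at hl hr ⊢
  nlinarith [mul_le_mul_of_nonneg_left hl h0]

lemma pairing_iterate_killedStep_self_le {σ : ℝ} (h0 : 0 ≤ σ) (h1 : σ ≤ 1 / 2) {f : ℕ → ℝ}
    (hf : FinitelySupported f) (n : ℕ) :
    pairing ((killedStep σ)^[n] f) ((killedStep σ)^[n] f) ≤ pairing f f := by
  induction n with
  | zero => exact le_rfl
  | succ n ih =>
    rw [Function.iterate_succ_apply']
    exact (pairing_killedStep_self_le h0 h1 (hf.iterate_killedStep σ n)).trans ih

/-- With l and r the two shifts of f, the parallelogram law gives ‖l - r‖² ≤ 2 ‖l - f‖² + 2 ‖r -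
f‖², the defect being ‖l + r - 2f‖² ≥ 0. The right side is at most 8 (⟨f, f⟩ - ⟨r, f⟩), a multiple
of the Dirichlet form of the walk. -/
lemma pairing_shiftDiff_self_le {σ : ℝ} (h0 : 0 < σ) {f : ℕ → ℝ} (hf : FinitelySupported f) :
    pairing (shiftDiff f) (shiftDiff f) ≤
      4 / σ * (pairing f f - pairing f (killedStep σ f)) := by
  have hl := hf.shiftLeft
  have hr := hf.shiftRight
  have h2 := hf.smul (-2)
  have hr1 := hr.smul (-1)
  have e1 : pairing (shiftRight f) f = pairing f (shiftLeft f) := pairing_shiftRight_left hf f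
  have e2 := pairing_shiftRight_self hf
  have e3 := pairing_shiftLeft_self_le hf
  have hpos := pairing_self_nonneg ((shiftLeft f + shiftRight f) + (-2 : ℝ) • f)
  rw [pairing_add_left (hl.add hr) h2, pairing_add_right _ (hl.add hr) h2,
    pairing_add_right _ (hl.add hr) h2, pairing_add_left hl hr, pairing_add_right _ hl hr,
    pairing_add_right _ hl hr, pairing_smul_left, pairing_smul_left, pairing_smul_right,
    pairing_smul_right, pairing_add_left hl hr, pairing_add_right _ hl hr,
    pairing_comm (shiftLeft f) f, pairing_comm (shiftRight f) (shiftLeft f), ← e1,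
    pairing_comm f (shiftRight f), e2] at hpos
  have hexp : pairing (shiftDiff f) (shiftDiff f) = pairing (shiftLeft f) (shiftLeft f) +
      pairing f f - 2 * pairing (shiftLeft f) (shiftRight f) := by
    rw [shiftDiff, pairing_add_left hl hr1, pairing_add_right _ hl hr1,
      pairing_add_right _ hl hr1, pairing_smul_left, pairing_smul_left, pairing_smul_right,
      pairing_smul_right, pairing_comm (shiftRight f) (shiftLeft f), e2]
    ring
  have hK : 4 / σ * (pairing f f - pairing f (killedStep σ f)) =
      8 * (pairing f f - pairing (shiftRight f) f) := by
    rw [pairing_killedStep_right σ hf, ← e1, pairing_comm f (shiftRight f)]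
    field_simp
    ring
  rw [hK, hexp]
  linarith

/-- The probability that the killed walk is at height `0` at time `n`. -/
def returnProb (σ : ℝ) (n : ℕ) : ℝ := (killedStep σ)^[n] zeroHeight 0

lemma pairing_iterate_zeroHeight (σ : ℝ) (a b : ℕ) :
    pairing ((killedStep σ)^[a] zeroHeight) ((killedStep σ)^[b] zeroHeight) =
      returnProb σ (a + b) := by
  have h := finitelySupported_zeroHeight
  rw [pairing_iterate_killedStep_left σ a h (h.iterate_killedStep σ b), pairing_zeroHeight,
    ← Function.iterate_add_apply, returnProb]

lemma pairing_shiftDiff_iterate_le {σ : ℝ} (h0 : 0 < σ) (a : ℕ) :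
    pairing (shiftDiff ((killedStep σ)^[a] zeroHeight))
      (shiftDiff ((killedStep σ)^[a] zeroHeight)) ≤
      4 / σ * (returnProb σ (2 * a) - returnProb σ (2 * a + 1)) := by
  have h := finitelySupported_zeroHeight.iterate_killedStep σ a
  have := pairing_shiftDiff_self_le h0 h
  rwa [← Function.iterate_succ_apply' (killedStep σ), pairing_iterate_zeroHeight,
    pairing_iterate_zeroHeight, ← two_mul, show a + a.succ = 2 * a + 1 by omega] at this

/-- The correlation of two step directions is bounded by the decrease of the return
probabilities. -/
lemma abs_direction_correlation_le {σ : ℝ} (h0 : 0 < σ) (h1 : σ ≤ 1 / 2) (i k m : ℕ) :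
    |(killedStep σ)^[i] (shiftDiff ((killedStep σ)^[k]
      (shiftDiff ((killedStep σ)^[m] zeroHeight)))) 0| ≤
      2 / σ * ((returnProb σ (2 * i) - returnProb σ (2 * i + 1)) +
        (returnProb σ (2 * m) - returnProb σ (2 * m + 1))) := by
  have h := finitelySupported_zeroHeight
  have hi := h.iterate_killedStep σ i
  have hm := (h.iterate_killedStep σ m).shiftDiff
  have hk := hm.iterate_killedStep σ k
  -- Symmetry of `killedStep` and antisymmetry of `shiftDiff` move the left half onto `zeroHeight`.
  -- The k middle steps only contract, so the bound does not depend on k.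
  rw [← pairing_zeroHeight ((killedStep σ)^[i] _), ← pairing_iterate_killedStep_left σ i h hk.shiftDiff,
    ← neg_eq_iff_eq_neg.2 (pairing_shiftDiff_left hi hk), abs_neg]
  refine (abs_pairing_le hi.shiftDiff hk).trans ?_
  have a1 := pairing_shiftDiff_iterate_le h0 i
  have a2 := (pairing_iterate_killedStep_self_le h0.le h1 hm k).trans
    (pairing_shiftDiff_iterate_le h0 m)
  have e : ∀ x : ℝ, 4 / σ * x = 2 * (2 / σ * x) := fun x => by ring
  rw [e] at a1 a2
  rw [mul_add]
  linarith

/-! ### From the height operator to the killed walk. -/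

/-- The rescaling that symmetrizes the transfer operator. -/
noncomputable def heightScale (s : ℕ) (f : ℕ → ℝ) (h : ℕ) : ℝ := f h / Real.sqrt s ^ h

/-- The total weight `2 √s + 1` of a step. -/
noncomputable def growthRate (s : ℕ) : ℝ := 2 * Real.sqrt s + 1

lemma growthRate_pos (s : ℕ) : 0 < growthRate s := by unfold growthRate; positivity

lemma sqrt_eq_sigmaConst_mul (s : ℕ) : Real.sqrt s = sigmaConst s * growthRate s := by
  have := (growthRate_pos s).ne'
  rw [sigmaConst, ← growthRate]
  field_simp

lemma one_sub_two_mul_sigmaConst (s : ℕ) : (1 - 2 * sigmaConst s) * growthRate s = 1 := by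
  have := sqrt_eq_sigmaConst_mul s
  have h : growthRate s = 2 * Real.sqrt s + 1 := rfl
  linarith

lemma shiftLeft_heightScale {s : ℕ} (hs : 0 < s) (f : ℕ → ℝ) (h : ℕ) :
    s * shiftLeft (heightScale s f) h = Real.sqrt s * heightScale s (shiftLeft f) h := by
  have hs' : 0 < Real.sqrt s := Real.sqrt_pos.2 (by exact_mod_cast hs)
  have hsq : (s : ℝ) = Real.sqrt s * Real.sqrt s := (Real.mul_self_sqrt (by positivity)).symm
  simp only [shiftLeft, heightScale]
  nth_rw 1 [hsq]
  field_simp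
  ring

lemma shiftRight_heightScale {s : ℕ} (hs : 0 < s) (f : ℕ → ℝ) (h : ℕ) :
    shiftRight (heightScale s f) h = Real.sqrt s * heightScale s (shiftRight f) h := by
  have hs' : 0 < Real.sqrt s := Real.sqrt_pos.2 (by exact_mod_cast hs)
  cases h with
  | zero => simp [shiftRight, heightScale]
  | succ h =>
    simp only [shiftRight, heightScale]
    field_simp
    ring

/-- The rescaling balances the up weight s and the down weight 1 into √s each; division by the total
2√s + 1 gives the probabilities σ, 1 - 2σ, σ. -/
lemma heightStep_heightScale {s : ℕ} (hs : 0 < s) (f : ℕ → ℝ) :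
    heightStep s (heightScale s f) =
      growthRate s • heightScale s (killedStep (sigmaConst s) f) := by
  funext h
  have h1 := one_sub_two_mul_sigmaConst s
  rw [heightStep, shiftLeft_heightScale hs, shiftRight_heightScale hs, sqrt_eq_sigmaConst_mul]
  simp only [Pi.smul_apply, smul_eq_mul, heightScale, killedStep, Pi.add_apply]
  nth_rw 1 [← one_mul (f h), ← h1]
  ring

lemma heightStep_sub (s : ℕ) (f g : ℕ → ℝ) (c : ℝ) :
    heightStep s (fun h => f h - c * g h) =
      fun h => heightStep s f h - c * heightStep s g h := by
  funext h
  cases h <;> simp [heightStep, shiftLeft, shiftRight] <;> ring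

lemma iterate_heightStep_sub (s n : ℕ) (f g : ℕ → ℝ) (c : ℝ) :
    (heightStep s)^[n] (fun h => f h - c * g h) =
      fun h => (heightStep s)^[n] f h - c * (heightStep s)^[n] g h := by
  induction n generalizing f g with
  | zero => rfl
  | succ n ih => rw [Function.iterate_succ_apply, heightStep_sub, ih]; rfl

lemma heightStep_smul (s : ℕ) (f : ℕ → ℝ) (c : ℝ) :
    heightStep s (c • f) = c • heightStep s f := by
  funext h
  cases h <;> simp [heightStep, shiftLeft, shiftRight] <;> ring

lemma iterate_heightStep_smul_heightScale {s : ℕ} (hs : 0 < s) (n : ℕ) (c : ℝ) (f : ℕ → ℝ) :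
    (heightStep s)^[n] (c • heightScale s f) =
      (c * growthRate s ^ n) • heightScale s ((killedStep (sigmaConst s))^[n] f) := by
  induction n generalizing c f with
  | zero => simp
  | succ n ih =>
    rw [Function.iterate_succ_apply, heightStep_smul, heightStep_heightScale hs, smul_smul, ih,
      Function.iterate_succ_apply, pow_succ']
    ring_nf

lemma heightScale_zeroHeight (s : ℕ) : heightScale s zeroHeight = zeroHeight := by
  funext h
  cases h <;> simp [heightScale, zeroHeight]

lemma iterate_heightStep_zeroHeight {s : ℕ} (hs : 0 < s) (n : ℕ) :
    (heightStep s)^[n] zeroHeight =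
      growthRate s ^ n • heightScale s ((killedStep (sigmaConst s))^[n] zeroHeight) := by
  have := iterate_heightStep_smul_heightScale hs n 1 zeroHeight
  rwa [one_smul, one_mul, heightScale_zeroHeight] at this

lemma iterate_heightStep_zeroHeight_zero {s : ℕ} (hs : 0 < s) (n : ℕ) :
    (heightStep s)^[n] zeroHeight 0 = growthRate s ^ n * returnProb (sigmaConst s) n := by
  rw [iterate_heightStep_zeroHeight hs]
  simp [heightScale, returnProb]

lemma signedStep_heightScale {s : ℕ} (hs : 0 < s) (c : ℝ) (f : ℕ → ℝ) :
    (fun h => meanColour s * (s * shiftLeft (c • heightScale s f) h -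
      shiftRight (c • heightScale s f) h)) =
      (c * (meanColour s * sigmaConst s * growthRate s)) • heightScale s (shiftDiff f) := by
  funext h
  have h1 := shiftLeft_heightScale hs f h
  have h2 := shiftRight_heightScale hs f h
  have e1 : shiftLeft (c • heightScale s f) h = c * shiftLeft (heightScale s f) h := rfl
  have e2 : shiftRight (c • heightScale s f) h = c * shiftRight (heightScale s f) h := by
    cases h <;> simp [shiftRight]
  rw [e1, e2, h2, mul_left_comm, h1, sqrt_eq_sigmaConst_mul]
  simp only [Pi.smul_apply, smul_eq_mul, heightScale, shiftDiff, Pi.add_apply]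
  ring

lemma stackChain_eq_iterate (s n : ℕ) (b : ℕ → Bool) (hb : ∀ k < n, b k = false) :
    stackChain s n b = (stackStep s false)^[n] emptyStack := by
  induction n generalizing b with
  | zero => rfl
  | succ n ih =>
    rw [stackChain, ih _ fun k hk => hb (k + 1) (by omega), hb 0 (by omega),
      Function.iterate_succ_apply']

lemma stackChain_add (s a n : ℕ) (b : ℕ → Bool) (hb : ∀ k < a, b k = false) :
    stackChain s (a + n) b =
      (stackStep s false)^[a] (stackChain s n fun k => b (k + a)) := by
  induction a generalizing b with
  | zero => simp
  | succ a ih =>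
    rw [show a + 1 + n = (a + n) + 1 by omega, stackChain,
      ih _ fun k hk => hb (k + 1) (by omega), hb 0 (by omega), Function.iterate_succ_apply']
    simp only [add_assoc]

lemma stackChain_two_marks {s i k m : ℕ} {b : ℕ → Bool}
    (hb : ∀ x, b x = true ↔ x = i ∨ x = i + 1 + k) :
    stackChain s (i + (k + (m + 1) + 1)) b = (stackStep s false)^[i] (stackStep s true
      ((stackStep s false)^[k] (stackStep s true ((stackStep s false)^[m] emptyStack)))) := by
  have hf : ∀ x, b x = false ↔ ¬ (x = i ∨ x = i + 1 + k) := fun x => by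
    rw [← hb, Bool.not_eq_true]
  rw [stackChain_add _ _ _ _ fun x hx => (hf x).2 (by omega), stackChain,
    stackChain_add _ _ _ _ fun x hx => (hf _).2 (by omega), stackChain,
    stackChain_eq_iterate _ _ _ fun x hx => (hf _).2 (by omega),
    (hb (0 + i)).2 (by omega), (hb (0 + k + 1 + i)).2 (by omega)]

/-- The first term treats every colour as equal to its mean, leaving a correlation of directions.
The second is the variance correction from walks in which the two marked steps are matched: they
enclose a walk of k steps, and the i + m outer steps form another one. -/
lemma stackChain_two_marks_nil {s : ℕ} (hs : 0 < s) {i k m : ℕ} {b : ℕ → Bool}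
    (hb : ∀ x, b x = true ↔ x = i ∨ x = i + 1 + k) :
    stackChain s (i + (k + (m + 1) + 1)) b [] =
      growthRate s ^ (i + k + m + 2) * ((meanColour s * sigmaConst s) ^ 2 *
        (killedStep (sigmaConst s))^[i] (shiftDiff ((killedStep (sigmaConst s))^[k]
          (shiftDiff ((killedStep (sigmaConst s))^[m] zeroHeight)))) 0 -
        ((s : ℝ) ^ 2 - 1) / 12 * sigmaConst s ^ 2 *
          (returnProb (sigmaConst s) k * returnProb (sigmaConst s) (i + m))) := by
  have haff : ∀ n, SlotAffine ((stackStep s false)^[n] emptyStack) := fun n => by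
    rw [← stackChain_eq_iterate s n (fun _ => false) fun _ _ => rfl]
    exact slotAffine_stackChain _ _ _
  have hit : ∀ n Φ, SlotAffine Φ → SlotAffine ((stackStep s false)^[n] Φ) := by
    intro n Φ hΦ
    induction n with
    | zero => exact hΦ
    | succ n ih =>
      rw [Function.iterate_succ_apply']
      exact ih.stackStep s _
  set X₀ := (stackStep s false)^[m] emptyStack with hX₀
  set X₁ := (stackStep s false)^[k] (stackStep s true X₀) with hX₁
  have hX₁aff : SlotAffine X₁ := hit k _ ((haff m).stackStep s _)
  have hmX₀ : meanField s X₀ = (heightStep s)^[m] zeroHeight := by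
    rw [hX₀, meanField_iterate_stackStep slotAffine_emptyStack, meanField_emptyStack]
  have hm₁ : meanField s (stackStep s true X₀) = fun h => meanColour s *
      (s * shiftLeft (meanField s X₀) h - shiftRight (meanField s X₀) h) := by
    funext h
    -- No marked site lies further right, so the slope in the colour vanishes.
    rw [meanField_stackStep_true (r := fun _ => 0)]
    · ring
    · intro c
      simp [hX₀, iterate_stackStep_emptyStack, -Function.iterate_succ]
  have hmX₁ : meanField s X₁ = (growthRate s ^ m *
      (meanColour s * sigmaConst s * growthRate s) * growthRate s ^ k) •
        heightScale s ((killedStep (sigmaConst s))^[k]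
          (shiftDiff ((killedStep (sigmaConst s))^[m] zeroHeight))) := by
    rw [hX₁, meanField_iterate_stackStep ((haff m).stackStep s _), hm₁, hmX₀,
      iterate_heightStep_zeroHeight hs, signedStep_heightScale hs,
      iterate_heightStep_smul_heightScale hs]
  have hm₂ : meanField s (stackStep s true X₁) = fun h =>
      meanColour s * (s * shiftLeft (meanField s X₁) h - shiftRight (meanField s X₁) h) -
        (s * ((s : ℝ) ^ 2 - 1) / 12 * (heightStep s)^[k] zeroHeight 0) *
          (heightStep s)^[m] zeroHeight h := by
    funext h
    -- The slope counts the walks that return after k steps, close the new up step at the second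
    -- marked site, and finish from height h in m steps.
    rw [meanField_stackStep_true (r := fun h => (heightStep s)^[k] zeroHeight 0 *
      (heightStep s)^[m] zeroHeight h)]
    · ring
    · intro c
      have := iterate_stackStep_slot s k m [] (List.replicate h (meanColour s)) c
      simpa using this
  have hsq : (s : ℝ) = (sigmaConst s * growthRate s) ^ 2 := by
    rw [← sqrt_eq_sigmaConst_mul, Real.sq_sqrt (by positivity)]
  rw [stackChain_two_marks hb]
  change meanField s ((stackStep s false)^[i] (stackStep s true X₁)) 0 = _
  rw [meanField_iterate_stackStep (hX₁aff.stackStep s _), hm₂,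
    iterate_heightStep_sub, hmX₁, signedStep_heightScale hs,
    iterate_heightStep_smul_heightScale hs, ← Function.iterate_add_apply,
    iterate_heightStep_zeroHeight_zero hs]
  beta_reduce
  rw [iterate_heightStep_zeroHeight_zero hs]
  simp only [Pi.smul_apply, smul_eq_mul, heightScale, pow_zero, div_one]
  have hγ : (s : ℝ) * ((s : ℝ) ^ 2 - 1) / 12 =
      (sigmaConst s * growthRate s) ^ 2 * ((s : ℝ) ^ 2 - 1) / 12 := by rw [← hsq]
  rw [hγ]
  ring

end

/-! ### Spectral integral and asymptotics of the return probabilities. -/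

section

open Real intervalIntegral

lemma integral_cos_nat_mul (k : ℕ) : ∫ θ in (0 : ℝ)..π, cos (((k : ℝ) + 1) * θ) = 0 := by
  have hk : ((k : ℝ) + 1) ≠ 0 := by positivity
  have h : sin (((k : ℝ) + 1) * π) = 0 := by exact_mod_cast sin_nat_mul_pi (k + 1)
  rw [integral_comp_mul_left _ hk]
  simp [h]

lemma integral_sin_mul_sin (h : ℕ) :
    ∫ θ in (0 : ℝ)..π, sin (((h : ℝ) + 1) * θ) * sin θ = π / 2 * zeroHeight h := by
  rcases h with _ | h
  · have := integral_sin_sq (a := 0) (b := π)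
    simp only [pow_two] at this
    simp [zeroHeight, this]
  · have e : ∀ θ : ℝ, sin (((h + 1 : ℕ) + 1 : ℝ) * θ) * sin θ =
        (1 / 2) * cos (((h : ℝ) + 1) * θ) - (1 / 2) * cos (((h + 2 : ℕ) + 1 : ℝ) * θ) := by
      intro θ
      have h1 : ((h : ℝ) + 1) * θ = ((h + 1 : ℕ) + 1 : ℝ) * θ - θ := by push_cast; ring
      have h2 : ((h + 2 : ℕ) + 1 : ℝ) * θ = ((h + 1 : ℕ) + 1 : ℝ) * θ + θ := by push_cast; ring
      rw [h1, h2, cos_sub, cos_add]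
      ring
    simp only [e]
    rw [integral_sub (Continuous.intervalIntegrable (by fun_prop) _ _)
      (Continuous.intervalIntegrable (by fun_prop) _ _), integral_const_mul, integral_const_mul,
      integral_cos_nat_mul, integral_cos_nat_mul]
    simp [zeroHeight]

/-- The functions sin((h + 1)θ) are generalized eigenfunctions of the killed walk, with eigenvalue 1
- 2σ + 2σ cos θ; they vanish at h = -1, which encodes the killing. -/
lemma iterate_killedStep_eq_integral (σ : ℝ) (n h : ℕ) :
    (killedStep σ)^[n] zeroHeight h = 2 / π *
      ∫ θ in (0 : ℝ)..π, sin (((h : ℝ) + 1) * θ) * (sin θ * (1 - 2 * σ + 2 * σ * cos θ) ^ n) := by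
  induction n generalizing h with
  | zero =>
    simp only [Function.iterate_zero, id_eq, pow_zero, mul_one, integral_sin_mul_sin]
    have := pi_ne_zero
    field_simp
  | succ n ih =>
    have hright : shiftRight ((killedStep σ)^[n] zeroHeight) h = 2 / π *
        ∫ θ in (0 : ℝ)..π, sin ((h : ℝ) * θ) * (sin θ * (1 - 2 * σ + 2 * σ * cos θ) ^ n) := by
      cases h with
      | zero => simp [shiftRight]
      | succ h =>
        rw [shiftRight, ih]
        push_cast
        rfl
    rw [Function.iterate_succ_apply', killedStep]
    simp only [Pi.add_apply, Pi.smul_apply, smul_eq_mul, shiftLeft, hright, ih]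
    rw [← mul_add, mul_left_comm, mul_left_comm σ, ← mul_add,
      ← integral_add (Continuous.intervalIntegrable (by fun_prop) _ _)
      (Continuous.intervalIntegrable (by fun_prop) _ _), ← integral_const_mul,
      ← integral_const_mul, ← integral_add (Continuous.intervalIntegrable (by fun_prop) _ _)
      (Continuous.intervalIntegrable (by fun_prop) _ _)]
    congr 1
    refine integral_congr fun θ _ => ?_
    have h1 : (((h + 1 : ℕ) : ℝ) + 1) * θ = ((h : ℝ) + 1) * θ + θ := by push_cast; ring
    have h2 : (h : ℝ) * θ = ((h : ℝ) + 1) * θ - θ := by ring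
    rw [h1, h2, sin_add, sin_sub, pow_succ]
    ring

/-- The density of the spectral measure of the killed walk, up to a constant, in terms of the
distance to the edge `1`. -/
noncomputable def edgeDensity (σ y : ℝ) : ℝ := √(y / σ * (1 - y / (4 * σ)))

lemma continuous_edgeDensity (σ : ℝ) : Continuous (edgeDensity σ) := by
  unfold edgeDensity
  fun_prop

/-- Substitution y = 2σ(1 - cos θ), the distance of the eigenvalue from 1. -/
lemma returnProb_eq_integral {σ : ℝ} (h0 : 0 < σ) (n : ℕ) :
    returnProb σ n = 1 / (π * σ) * ∫ y in (0 : ℝ)..(4 * σ), (1 - y) ^ n * edgeDensity σ y := by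
  have hsub := integral_comp_mul_deriv (a := 0) (b := π) (f := fun θ => 2 * σ * (1 - cos θ))
    (f' := fun θ => 2 * σ * sin θ) (g := fun y => (1 - y) ^ n * edgeDensity σ y)
    (fun θ _ => by
      have := ((hasDerivAt_cos θ).const_sub 1).const_mul (2 * σ)
      simpa using this)
    (by fun_prop) (by have := continuous_edgeDensity σ; fun_prop)
  simp only [cos_zero, sub_self, mul_zero, cos_pi] at hsub
  rw [show 2 * σ * (1 - -1) = 4 * σ by ring] at hsub
  rw [returnProb, iterate_killedStep_eq_integral, ← hsub, ← integral_const_mul,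
    ← integral_const_mul]
  refine integral_congr fun θ hθ => ?_
  rw [Set.uIcc_of_le pi_pos.le] at hθ
  have hs : edgeDensity σ (2 * σ * (1 - cos θ)) = sin θ := by
    rw [edgeDensity, show 2 * σ * (1 - cos θ) / σ * (1 - 2 * σ * (1 - cos θ) / (4 * σ)) =
      sin θ ^ 2 by rw [sin_sq]; field_simp; ring]
    exact sqrt_sq (sin_nonneg_of_nonneg_of_le_pi hθ.1 hθ.2)
  have hb : 1 - 2 * σ * (1 - cos θ) = 1 - 2 * σ + 2 * σ * cos θ := by ring
  simp only [Function.comp, hs, Nat.cast_zero, zero_add, one_mul, hb]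
  field_simp

lemma edgeDensity_eq {σ y : ℝ} (h0 : 0 < σ) (hy : 0 ≤ y) :
    edgeDensity σ y = √y / √σ * √(1 - y / (4 * σ)) := by
  rw [edgeDensity, sqrt_mul (by positivity), sqrt_div hy]

lemma edgeDensity_le_one {σ : ℝ} (h0 : 0 < σ) (y : ℝ) : edgeDensity σ y ≤ 1 := by
  rw [edgeDensity, sqrt_le_one]
  have : y / σ * (1 - y / (4 * σ)) = 1 - (1 - y / (2 * σ)) ^ 2 := by field_simp; ring
  rw [this]
  linarith [sq_nonneg (1 - y / (2 * σ))]

lemma edgeDensity_le {σ y : ℝ} (h0 : 0 < σ) (hy : 0 ≤ y) : edgeDensity σ y ≤ √y / √σ := by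
  rw [edgeDensity_eq h0 hy]
  refine mul_le_of_le_one_right (by positivity) (sqrt_le_one.2 ?_)
  linarith [show 0 ≤ y / (4 * σ) by positivity]

lemma le_edgeDensity {σ y : ℝ} (h0 : 0 < σ) (hy : 0 ≤ y) (hy' : y ≤ 4 * σ) :
    √y / √σ - √y * y / (4 * σ * √σ) ≤ edgeDensity σ y := by
  have h1 : 0 ≤ 1 - y / (4 * σ) := by
    rw [sub_nonneg, div_le_one (by positivity)]
    exact hy'
  have h2 : 1 - y / (4 * σ) ≤ √(1 - y / (4 * σ)) := by
    refine le_sqrt_of_sq_le ?_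
    have : 0 ≤ y / (4 * σ) := by positivity
    nlinarith
  rw [edgeDensity_eq h0 hy]
  refine le_trans (le_of_eq ?_) (mul_le_mul_of_nonneg_left h2 (by positivity))
  have := (sqrt_pos.2 h0).ne'
  field_simp

/-- The Beta integral `B(n + 1, 3 / 2)`. -/
noncomputable def betaHalf (n : ℕ) : ℝ := ∫ y in (0 : ℝ)..1, (1 - y) ^ n * √y

lemma betaHalf_sub_succ (n : ℕ) :
    betaHalf n - betaHalf (n + 1) = ∫ y in (0 : ℝ)..1, (1 - y) ^ n * (√y * y) := by
  rw [betaHalf, betaHalf, ← integral_sub (Continuous.intervalIntegrable (by fun_prop) _ _)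
      (Continuous.intervalIntegrable (by fun_prop) _ _)]
  refine integral_congr fun y _ => ?_
  ring

lemma betaHalf_zero : betaHalf 0 = 2 / 3 := by
  simp only [betaHalf, pow_zero, one_mul, sqrt_eq_rpow]
  rw [integral_rpow (by norm_num)]
  norm_num

/-- Integration by parts: (1 - y)^(n+1) y^(3/2) vanishes at both ends. -/
lemma betaHalf_succ (n : ℕ) : ((n : ℝ) + 5 / 2) * betaHalf (n + 1) = (n + 1) * betaHalf n := by
  have hd : ∀ y ∈ Set.uIcc (0 : ℝ) 1, HasDerivAt (fun y : ℝ => (1 - y) ^ (n + 1) * y ^ (3 / 2 : ℝ))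
      (3 / 2 * ((1 - y) ^ (n + 1) * √y) - (n + 1) * ((1 - y) ^ n * (√y * y))) y := by
    intro y hy
    rw [Set.uIcc_of_le zero_le_one] at hy
    have h1 := ((hasDerivAt_id y).const_sub 1).pow (n + 1)
    have h2 := hasDerivAt_rpow_const (x := y) (p := 3 / 2) (Or.inr (by norm_num))
    refine (h1.mul h2).congr_deriv ?_
    have e1 : y ^ (3 / 2 : ℝ) = √y * y := by
      rw [sqrt_eq_rpow, ← rpow_add_one' hy.1 (by norm_num)]
      norm_num
    have e2 : y ^ (3 / 2 - 1 : ℝ) = √y := by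
      rw [sqrt_eq_rpow]
      norm_num
    rw [e1, e2]
    simp
    ring
  have hint := integral_eq_sub_of_hasDerivAt hd (Continuous.intervalIntegrable (by fun_prop) _ _)
  rw [integral_sub (Continuous.intervalIntegrable (by fun_prop) _ _)
    (Continuous.intervalIntegrable (by fun_prop) _ _), integral_const_mul, integral_const_mul,
    ← betaHalf_sub_succ, ← betaHalf] at hint
  norm_num at hint
  linarith

lemma betaHalf_eq_Gamma (n : ℕ) :
    betaHalf n = √π / 2 * (Gamma (n + 1) / Gamma (n + 5 / 2)) := by
  induction n with
  | zero =>
    have h1 : Gamma (1 / 2 + 1) = 1 / 2 * Gamma (1 / 2) := Gamma_add_one (by norm_num)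
    have h2 : Gamma (3 / 2 + 1) = 3 / 2 * Gamma (3 / 2) := Gamma_add_one (by norm_num)
    norm_num at h1 h2
    rw [betaHalf_zero]
    norm_num
    rw [h2, h1, Gamma_one_half_eq]
    have := (sqrt_pos.2 pi_pos).ne'
    field_simp
  | succ n ih =>
    have h1 : Gamma ((n + 1 : ℝ) + 1) = (n + 1) * Gamma (n + 1) := Gamma_add_one (by positivity)
    have h2 : Gamma ((n + 5 / 2 : ℝ) + 1) = (n + 5 / 2) * Gamma (n + 5 / 2) :=
      Gamma_add_one (by positivity)
    have h3 := betaHalf_succ n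
    have h4 : (0 : ℝ) < n + 5 / 2 := by positivity
    have h5 := (Gamma_pos_of_pos h4).ne'
    push_cast
    rw [h1, show (n : ℝ) + 1 + 5 / 2 = n + 5 / 2 + 1 by ring, h2]
    rw [← mul_right_inj' h4.ne', h3, ih]
    field_simp

/-- Log-convexity of Γ at the midpoint of x and x + 1. Used at x and at x + 1/2, it yields both
bounds in `betaHalf_bounds`. -/
lemma Gamma_add_half_le {x : ℝ} (hx : 0 < x) : Gamma (x + 1 / 2) ≤ Gamma x * √x := by
  have h := Gamma_mul_add_mul_le_rpow_Gamma_mul_rpow_Gamma hx (by linarith : 0 < x + 1)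
    (a := 1 / 2) (b := 1 / 2) (by norm_num) (by norm_num) (by norm_num)
  have hG := Gamma_pos_of_pos hx
  rw [← sqrt_eq_rpow, ← sqrt_eq_rpow, Gamma_add_one hx.ne', sqrt_mul hx.le, mul_left_comm,
    mul_self_sqrt hG.le, show 1 / 2 * x + 1 / 2 * (x + 1) = x + 1 / 2 by ring] at h
  linarith

lemma betaHalf_bounds (n : ℕ) :
    √π / 2 * (1 / (((n : ℝ) + 3 / 2) * √(n + 1))) ≤ betaHalf n ∧
      betaHalf n ≤ √π / 2 * (1 / (((n : ℝ) + 1) * √(n + 1))) := by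
  set x : ℝ := n + 1 with hx
  have hx0 : 0 < x := by positivity
  have hG := Gamma_pos_of_pos hx0
  have hG' : 0 < Gamma (x + 1 / 2) := Gamma_pos_of_pos (by positivity)
  have hq : 0 < √x := sqrt_pos.2 hx0
  have h1 := Gamma_add_half_le hx0
  have h2 := Gamma_add_half_le (by positivity : 0 < x + 1 / 2)
  rw [show x + 1 / 2 + 1 / 2 = x + 1 by ring, Gamma_add_one hx0.ne'] at h2
  have h3 : Gamma ((n : ℝ) + 5 / 2) = (x + 1 / 2) * Gamma (x + 1 / 2) := by
    rw [← Gamma_add_one (by positivity)]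
    congr 1
    rw [hx]
    ring
  have h4 : √(x + 1 / 2) * √x ≤ x + 1 / 2 := by
    rw [← sqrt_mul (by positivity), sqrt_le_left (by positivity)]
    nlinarith
  rw [betaHalf_eq_Gamma, ← hx, h3, show (n : ℝ) + 3 / 2 = x + 1 / 2 by rw [hx]; ring]
  constructor
  · refine mul_le_mul_of_nonneg_left ?_ (by positivity)
    rw [div_le_div_iff₀ (by positivity) (by positivity)]
    nlinarith
  · refine mul_le_mul_of_nonneg_left ?_ (by positivity)
    rw [div_le_div_iff₀ (by positivity) (by positivity)]
    have := mul_le_mul_of_nonneg_right h2 hq.le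
    nlinarith [mul_le_mul_of_nonneg_left h4 hG'.le]

/-- The scale of the error terms, `(n + 1) ^ (-5 / 2)`. -/
noncomputable def errorScale (n : ℕ) : ℝ := 1 / (((n : ℝ) + 1) ^ 2 * √(n + 1))

lemma errorScale_pos (n : ℕ) : 0 < errorScale n := by unfold errorScale; positivity

lemma sqrt_pi_le_two : √π ≤ 2 := by
  rw [sqrt_le_left (by norm_num)]
  linarith [pi_le_four]

lemma abs_betaHalf_sub_le (n : ℕ) :
    |betaHalf n - √π / 2 * (1 / (((n : ℝ) + 1) * √(n + 1)))| ≤ errorScale n := by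
  obtain ⟨h1, h2⟩ := betaHalf_bounds n
  rw [abs_sub_comm, abs_of_nonneg (by linarith)]
  have hq : 0 < √((n : ℝ) + 1) := sqrt_pos.2 (by positivity)
  have h3 : 1 / (((n : ℝ) + 1) * √(n + 1)) - 1 / (((n : ℝ) + 3 / 2) * √(n + 1)) ≤
      errorScale n := by
    rw [errorScale, sub_le_iff_le_add, div_add_div _ _ (by positivity) (by positivity),
      div_le_div_iff₀ (by positivity) (by positivity)]
    generalize √((n : ℝ) + 1) = q at *
    have : (0 : ℝ) ≤ n := n.cast_nonneg
    have e : (1 * (((n : ℝ) + 3 / 2) * q) + ((n : ℝ) + 1) ^ 2 * q * 1) * (((n : ℝ) + 1) * q) -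
      1 * (((n : ℝ) + 1) ^ 2 * q * (((n : ℝ) + 3 / 2) * q)) =
        q ^ 2 * ((n : ℝ) + 1) * (n / 2 + 1) := by ring
    have : 0 ≤ q ^ 2 * ((n : ℝ) + 1) * (n / 2 + 1) := by positivity
    linarith
  have hpos := errorScale_pos n
  calc _ ≤ √π / 2 * (1 / (((n : ℝ) + 1) * √(n + 1)) - 1 / (((n : ℝ) + 3 / 2) * √(n + 1))) := by
        linarith
    _ ≤ √π / 2 * errorScale n := by gcongr
    _ ≤ 1 * errorScale n := by
        gcongr
        linarith [sqrt_pi_le_two]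
    _ = errorScale n := one_mul _

lemma betaHalf_sub_succ_nonneg (n : ℕ) : 0 ≤ betaHalf n - betaHalf (n + 1) := by
  rw [betaHalf_sub_succ]
  refine integral_nonneg zero_le_one fun y hy => ?_
  have : 0 ≤ 1 - y := by linarith [hy.2]
  have := hy.1
  positivity

lemma betaHalf_sub_succ_le (n : ℕ) : betaHalf n - betaHalf (n + 1) ≤ 3 / 2 * errorScale n := by
  have h := betaHalf_succ n
  obtain ⟨h1, h2⟩ := betaHalf_bounds n
  have hq : 0 < √((n : ℝ) + 1) := sqrt_pos.2 (by positivity)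
  have hn : (0 : ℝ) < n + 5 / 2 := by positivity
  have h3 : betaHalf n ≤ 1 / (((n : ℝ) + 1) * √(n + 1)) := by
    refine h2.trans (mul_le_of_le_one_left (by positivity) ?_)
    linarith [sqrt_pi_le_two]
  have h4 : ((n : ℝ) + 5 / 2) * (betaHalf n - betaHalf (n + 1)) = 3 / 2 * betaHalf n := by
    rw [mul_sub, h]
    ring
  have h5 : betaHalf n ≤ ((n : ℝ) + 1) * errorScale n := by
    refine h3.trans (le_of_eq ?_)
    rw [errorScale]
    field_simp
  have h6 := errorScale_pos n
  rw [← mul_le_mul_iff_right₀ hn, h4]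
  nlinarith

lemma exists_pow_le_errorScale {r : ℝ} (h0 : 0 < r) (h1 : r < 1) :
    ∃ C, 0 < C ∧ ∀ n : ℕ, r ^ n ≤ C * errorScale n := by
  -- Any integer exponent from 3 on would do, as it must beat 5/2.
  obtain ⟨B, hB⟩ := (tendsto_pow_const_mul_const_pow_of_abs_lt_one 3
    (by rwa [abs_of_pos h0] : |r| < 1)).bddAbove_range
  have hB0 : 0 ≤ B := by simpa using hB ⟨0, rfl⟩
  refine ⟨B / r + 1, by positivity, fun n => ?_⟩
  have h := hB ⟨n + 1, rfl⟩
  simp only at h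
  push_cast at h
  have hx : (1 : ℝ) ≤ n + 1 := by linarith [n.cast_nonneg (α := ℝ)]
  have hq : √((n : ℝ) + 1) ≤ n + 1 := by
    rw [sqrt_le_left (by linarith)]
    nlinarith
  have hq0 : 0 < √((n : ℝ) + 1) := sqrt_pos.2 (by linarith)
  have h2 : ((n : ℝ) + 1) ^ 3 * r ^ n ≤ B / r := by
    rw [le_div_iff₀ h0]
    calc _ = ((n : ℝ) + 1) ^ 3 * r ^ (n + 1) := by ring
      _ ≤ B := h
  rw [errorScale, mul_one_div, le_div_iff₀ (by positivity)]
  calc r ^ n * (((n : ℝ) + 1) ^ 2 * √(n + 1)) ≤ r ^ n * (((n : ℝ) + 1) ^ 2 * (n + 1)) := by gcongr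
    _ = ((n : ℝ) + 1) ^ 3 * r ^ n := by ring
    _ ≤ B / r + 1 := by linarith

/-- The part of the spectral integral over positive eigenvalues. -/
noncomputable def edgePart (σ : ℝ) (n : ℕ) : ℝ := ∫ y in (0 : ℝ)..1, (1 - y) ^ n * edgeDensity σ y

/-- The part of the spectral integral over negative eigenvalues. -/
noncomputable def bulkPart (σ : ℝ) (n : ℕ) : ℝ :=
  ∫ y in (1 : ℝ)..(4 * σ), (1 - y) ^ n * edgeDensity σ y

lemma intervalIntegrable_pow_mul_edgeDensity (σ a b : ℝ) (n : ℕ) :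
    IntervalIntegrable (fun y => (1 - y) ^ n * edgeDensity σ y) MeasureTheory.volume a b :=
  Continuous.intervalIntegrable (by have := continuous_edgeDensity σ; fun_prop) _ _

lemma returnProb_eq_edgePart_add_bulkPart {σ : ℝ} (h0 : 0 < σ) (n : ℕ) :
    returnProb σ n = 1 / (π * σ) * (edgePart σ n + bulkPart σ n) := by
  rw [returnProb_eq_integral h0, edgePart, bulkPart, integral_add_adjacent_intervals] <;>
  exact intervalIntegrable_pow_mul_edgeDensity _ _ _ _

/-- Here |1 - y| ≤ 4σ - 1 < 1, so negative eigenvalues contribute exponentially little; the interval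
has length below 1. -/
lemma abs_bulkPart_le {σ : ℝ} (h0 : 1 / 4 < σ) (h1 : σ < 1 / 2) (n : ℕ) :
    |bulkPart σ n| ≤ (4 * σ - 1) ^ n := by
  have h := norm_integral_le_of_norm_le_const (a := 1) (b := 4 * σ) (C := (4 * σ - 1) ^ n)
    (f := fun y => (1 - y) ^ n * edgeDensity σ y) (fun y hy => by
      rw [Set.uIoc_of_le (by linarith)] at hy
      rw [norm_mul, norm_pow, Real.norm_eq_abs, Real.norm_eq_abs, abs_sub_comm,
        abs_of_nonneg (by linarith [hy.1] : 0 ≤ y - 1),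
        abs_of_nonneg (show 0 ≤ edgeDensity σ y from sqrt_nonneg _)]
      calc (y - 1) ^ n * edgeDensity σ y ≤ (y - 1) ^ n * 1 := by
            have : 0 ≤ y - 1 := by linarith [hy.1]
            gcongr
            exact edgeDensity_le_one (by linarith) y
        _ ≤ (4 * σ - 1) ^ n := by
            rw [mul_one]
            exact pow_le_pow_left₀ (by linarith [hy.1]) (by linarith [hy.2]) n)
  refine h.trans (mul_le_of_le_one_right (pow_nonneg (by linarith) n) ?_)
  rw [abs_of_nonneg] <;> linarith

/-- Replacing √(1 - y/(4σ)) by 1 costs at most y/(4σ), and an additional factor y in the Beta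
integral produces a difference of consecutive ones. -/
lemma abs_edgePart_sub_le {σ : ℝ} (h0 : 1 / 4 < σ) (n : ℕ) :
    |edgePart σ n - betaHalf n / √σ| ≤
      (betaHalf n - betaHalf (n + 1)) / (4 * σ * √σ) := by
  have hσ : 0 < σ := by linarith
  have h1 : edgePart σ n ≤ betaHalf n / √σ := by
    rw [edgePart, betaHalf, ← integral_div]
    refine integral_mono_on zero_le_one (intervalIntegrable_pow_mul_edgeDensity _ _ _ _)
      (Continuous.intervalIntegrable (by fun_prop) _ _) fun y hy => ?_
    rw [mul_div_assoc]
    exact mul_le_mul_of_nonneg_left (edgeDensity_le hσ hy.1)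
      (pow_nonneg (by linarith [hy.2]) n)
  have h2 : betaHalf n / √σ - (betaHalf n - betaHalf (n + 1)) / (4 * σ * √σ) ≤ edgePart σ n := by
    rw [betaHalf_sub_succ, edgePart, betaHalf, ← integral_div, ← integral_div,
      ← integral_sub (Continuous.intervalIntegrable (by fun_prop) _ _)
        (Continuous.intervalIntegrable (by fun_prop) _ _)]
    refine integral_mono_on zero_le_one (Continuous.intervalIntegrable (by fun_prop) _ _)
      (intervalIntegrable_pow_mul_edgeDensity _ _ _ _) fun y hy => ?_
    rw [mul_div_assoc, mul_div_assoc, ← mul_sub]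
    exact mul_le_mul_of_nonneg_left (le_edgeDensity hσ hy.1 (by linarith [hy.2]))
      (pow_nonneg (by linarith [hy.2]) n)
  rw [abs_le]
  have := div_nonneg (betaHalf_sub_succ_nonneg n) (by positivity : 0 ≤ 4 * σ * √σ)
  constructor <;> linarith

lemma edgePart_sub_succ_le {σ : ℝ} (h0 : 1 / 4 < σ) (n : ℕ) :
    |edgePart σ n - edgePart σ (n + 1)| ≤ (betaHalf n - betaHalf (n + 1)) / √σ := by
  have hσ : 0 < σ := by linarith
  have hc := continuous_edgeDensity σ
  have e : edgePart σ n - edgePart σ (n + 1) =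
      ∫ y in (0 : ℝ)..1, (1 - y) ^ n * (edgeDensity σ y * y) := by
    rw [edgePart, edgePart, ← integral_sub (intervalIntegrable_pow_mul_edgeDensity _ _ _ _)
      (intervalIntegrable_pow_mul_edgeDensity _ _ _ _)]
    refine integral_congr fun y _ => ?_
    ring
  rw [e, abs_of_nonneg]
  · rw [betaHalf_sub_succ, ← integral_div]
    refine integral_mono_on zero_le_one (Continuous.intervalIntegrable (by fun_prop) _ _)
      (Continuous.intervalIntegrable (by fun_prop) _ _) fun y hy => ?_
    rw [mul_div_assoc, mul_div_right_comm]
    exact mul_le_mul_of_nonneg_left (mul_le_mul_of_nonneg_right (edgeDensity_le hσ hy.1) hy.1)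
      (pow_nonneg (by linarith [hy.2]) n)
  · refine integral_nonneg zero_le_one fun y hy => ?_
    exact mul_nonneg (pow_nonneg (by linarith [hy.2]) n) (mul_nonneg (sqrt_nonneg _) hy.1)

/-- The constant in the asymptotics of the return probabilities. -/
noncomputable def returnConst (σ : ℝ) : ℝ := 1 / (2 * √π * (σ * √σ))

lemma exists_abs_returnProb_sub_le {σ : ℝ} (h0 : 1 / 4 < σ) (h1 : σ < 1 / 2) :
    ∃ C, 0 < C ∧ ∀ n : ℕ,
      |returnProb σ n - returnConst σ * (1 / (((n : ℝ) + 1) * √(n + 1)))| ≤ C * errorScale n ∧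
      |returnProb σ n - returnProb σ (n + 1)| ≤ C * errorScale n := by
  have hσ : 0 < σ := by linarith
  have hq : 0 < √σ := sqrt_pos.2 hσ
  have hπ : 0 < √π := sqrt_pos.2 pi_pos
  obtain ⟨B, hB0, hB⟩ := exists_pow_le_errorScale (r := 4 * σ - 1) (by linarith) (by linarith)
  refine ⟨1 / (π * σ) * (1 / √σ + 3 / 2 / (4 * σ * √σ) + 3 / 2 / √σ + 2 * B), by positivity,
    fun n => ?_⟩
  have hE := errorScale_pos n
  have hbulk : ∀ k, n ≤ k → |bulkPart σ k| ≤ B * errorScale n := fun k hk =>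
    (abs_bulkPart_le h0 h1 k).trans
      ((pow_le_pow_of_le_one (by linarith) (by linarith) hk).trans (hB n))
  have hd := betaHalf_sub_succ_le n
  have hpos : 0 < 1 / (π * σ) := by positivity
  constructor
  · have e : returnProb σ n - returnConst σ * (1 / (((n : ℝ) + 1) * √(n + 1))) = 1 / (π * σ) *
        ((edgePart σ n - betaHalf n / √σ) + bulkPart σ n +
          (betaHalf n - √π / 2 * (1 / (((n : ℝ) + 1) * √(n + 1)))) / √σ) := by
      have hc : returnConst σ = 1 / (π * σ) * (√π / 2 / √σ) := by
        rw [returnConst]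
        nth_rw 2 [← mul_self_sqrt pi_pos.le]
        field_simp
      rw [returnProb_eq_edgePart_add_bulkPart hσ, hc]
      ring
    rw [e, abs_mul, abs_of_pos hpos, mul_assoc]
    refine mul_le_mul_of_nonneg_left ?_ hpos.le
    have a1 := (abs_edgePart_sub_le h0 n).trans
      (div_le_div_of_nonneg_right hd (by positivity : 0 ≤ 4 * σ * √σ))
    have a2 := hbulk n le_rfl
    have a3 := div_le_div_of_nonneg_right (abs_betaHalf_sub_le n) hq.le
    refine ((abs_add_le _ _).trans (add_le_add_left (abs_add_le _ _) _)).trans ?_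
    rw [abs_div _ (√σ), abs_of_pos hq]
    have : 0 ≤ 3 / 2 / √σ * errorScale n := by positivity
    have : 0 ≤ B * errorScale n := by positivity
    have e1 : 3 / 2 * errorScale n / (4 * σ * √σ) = 3 / 2 / (4 * σ * √σ) * errorScale n := by ring
    have e2 : errorScale n / √σ = 1 / √σ * errorScale n := by ring
    rw [e1] at a1
    rw [e2] at a3
    linarith
  · have e : returnProb σ n - returnProb σ (n + 1) = 1 / (π * σ) *
        ((edgePart σ n - edgePart σ (n + 1)) + (bulkPart σ n - bulkPart σ (n + 1))) := by
      rw [returnProb_eq_edgePart_add_bulkPart hσ, returnProb_eq_edgePart_add_bulkPart hσ]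
      ring
    rw [e, abs_mul, abs_of_pos hpos, mul_assoc]
    refine mul_le_mul_of_nonneg_left ?_ hpos.le
    have a1 := (edgePart_sub_succ_le h0 n).trans (div_le_div_of_nonneg_right hd hq.le)
    have a2 := hbulk n le_rfl
    have a3 := hbulk (n + 1) (by omega)
    have a4 := abs_sub (bulkPart σ n) (bulkPart σ (n + 1))
    refine (abs_add_le _ _).trans ?_
    have : 0 ≤ 3 / 2 / (4 * σ * √σ) * errorScale n := by positivity
    have : 0 ≤ 1 / √σ * errorScale n := by positivity
    have e1 : 3 / 2 * errorScale n / √σ = 3 / 2 / √σ * errorScale n := by ring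
    rw [e1] at a1
    linarith

end

/-! ### Ground state expectations and the final estimate. -/

open Finset in
lemma card_motzkinWalks {s : ℕ} (hs : 0 < s) (n : ℕ) :
    ((motzkinWalks s n).card : ℝ) = growthRate s ^ n * returnProb (sigmaConst s) n := by
  classical
  have h := completionSum_eq_stackChain s n (fun _ => false) [] (by simp)
  rw [List.map_nil, stackChain_eq_iterate s n (fun _ => false) (fun _ _ => rfl),
    iterate_stackStep_emptyStack, List.length_nil, iterate_heightStep_zeroHeight_zero hs] at h
  rw [← h, completionSum, motzkinWalks, card_filter]
  push_cast
  refine sum_congr rfl fun w _ => ?_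
  simp [isMotzkin_iff_motzkinFrom_nil, stepWeight]

open Finset in
lemma sum_motzkinWalks_mul {s : ℕ} (hs : 0 < s) {n i k m : ℕ} {a c : Fin n}
    (ha : (a : ℕ) = i) (hc : (c : ℕ) = i + 1 + k) (hn : n = i + (k + (m + 1) + 1)) :
    ∑ w ∈ motzkinWalks s n, (((w a : ℤ) : ℝ) * ((w c : ℤ) : ℝ)) =
      growthRate s ^ n * ((meanColour s * sigmaConst s) ^ 2 *
        (killedStep (sigmaConst s))^[i] (shiftDiff ((killedStep (sigmaConst s))^[k]
          (shiftDiff ((killedStep (sigmaConst s))^[m] zeroHeight)))) 0 -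
        ((s : ℝ) ^ 2 - 1) / 12 * sigmaConst s ^ 2 *
          (returnProb (sigmaConst s) k * returnProb (sigmaConst s) (i + m))) := by
  classical
  set b : ℕ → Bool := fun x => decide (x = i ∨ x = i + 1 + k) with hb
  have h := completionSum_eq_stackChain s n b [] (by simp)
  have hchain := stackChain_two_marks_nil hs (i := i) (k := k) (m := m) (b := b) (by simp [hb])
  rw [← hn] at hchain
  rw [List.map_nil, hchain, show i + k + m + 2 = n by omega] at h
  rw [← h, completionSum, motzkinWalks, sum_filter]
  refine sum_congr rfl fun w _ => ?_
  simp only [isMotzkin_iff_motzkinFrom_nil]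
  congr 1
  have hac : a ≠ c := fun h => by
    rw [h] at ha
    omega
  have hprod : ∀ x : Fin n, stepWeight (b x) ((w x : ℤ) : ℝ) =
      (if a = x then ((w x : ℤ) : ℝ) else 1) * (if c = x then ((w x : ℤ) : ℝ) else 1) := by
    intro x
    have hbx : b x = true ↔ x = a ∨ x = c := by simp [hb, Fin.ext_iff, ha, hc]
    simp only [stepWeight, hbx]
    by_cases h1 : x = a
    · subst h1
      simp [hac.symm]
    · by_cases h2 : x = c
      · subst h2
        simp [hac]
      · simp [h1, h2, Ne.symm h1, Ne.symm h2]
  simp only [hprod, prod_mul_distrib, prod_ite_eq, mem_univ, if_true]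

lemma spinZ_apply {s n : ℕ} (i : Fin n) (ψ : ChainSpace s n) (w : Walk s n) :
    spinZ i ψ w = ((w i : ℤ) : ℂ) * ψ w := by
  simp [spinZ, Matrix.toEuclideanLin, Matrix.toLpLin_apply, Matrix.mulVec_diagonal]

open Classical in
lemma groundState_apply {s n : ℕ} (w : Walk s n) :
    groundState s n w =
      if w ∈ motzkinWalks s n then (((Real.sqrt ((motzkinWalks s n).card : ℝ))⁻¹ : ℝ) : ℂ)
      else 0 := by
  simp [groundState, Finset.sum_apply, Pi.single_apply]

lemma corrZZ_eq {s n : ℕ} (i j : Fin n) :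
    corrZZ s n i j = (((∑ w ∈ motzkinWalks s n, (((w i : ℤ) : ℝ) * ((w j : ℤ) : ℝ))) /
      ((motzkinWalks s n).card : ℝ) : ℝ) : ℂ) := by
  classical
  have hsq : ((Real.sqrt ((motzkinWalks s n).card : ℝ))⁻¹) ^ 2 =
      ((motzkinWalks s n).card : ℝ)⁻¹ := by
    rw [inv_pow, Real.sq_sqrt (by positivity)]
  rw [corrZZ, PiLp.inner_apply, div_eq_mul_inv, ← hsq, Finset.sum_mul, Complex.ofReal_sum,
    ← Finset.sum_subset (Finset.subset_univ (motzkinWalks s n))]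
  · refine Finset.sum_congr rfl fun w hw => ?_
    rw [spinZ_apply, spinZ_apply, groundState_apply, if_pos hw]
    generalize (Real.sqrt ((motzkinWalks s n).card : ℝ))⁻¹ = q
    simp
    ring
  · intro w _ hw
    rw [groundState_apply, if_neg hw]
    simp

lemma motzkinWalks_nonempty (s n : ℕ) : (motzkinWalks s n).Nonempty := by
  classical
  refine ⟨fun _ => ⟨0, by simp⟩, ?_⟩
  rw [motzkinWalks, Finset.mem_filter]
  refine ⟨Finset.mem_univ _, fun x _ => by simp [height], by simp [height], fun a c h => ?_⟩
  simp

/-- Positivity is read off from the count of Motzkin walks, since the flat walk is one. -/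
lemma returnProb_sigmaConst_pos {s : ℕ} (hs : 0 < s) (n : ℕ) :
    0 < returnProb (sigmaConst s) n := by
  have h := card_motzkinWalks hs n
  have hc : (0 : ℝ) < (motzkinWalks s n).card := by
    exact_mod_cast (motzkinWalks_nonempty s n).card_pos
  rw [h] at hc
  exact pos_of_mul_pos_right hc (pow_pos (growthRate_pos s) n).le

lemma corrZZ_eq_returnProb {s : ℕ} (hs : 0 < s) {n i k m : ℕ} {a c : Fin n}
    (ha : (a : ℕ) = i) (hc : (c : ℕ) = i + 1 + k) (hn : n = i + (k + (m + 1) + 1)) :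
    corrZZ s n a c = ((((meanColour s * sigmaConst s) ^ 2 *
        (killedStep (sigmaConst s))^[i] (shiftDiff ((killedStep (sigmaConst s))^[k]
          (shiftDiff ((killedStep (sigmaConst s))^[m] zeroHeight)))) 0 -
        ((s : ℝ) ^ 2 - 1) / 12 * sigmaConst s ^ 2 *
          (returnProb (sigmaConst s) k * returnProb (sigmaConst s) (i + m))) /
            returnProb (sigmaConst s) n : ℝ) : ℂ) := by
  rw [corrZZ_eq, sum_motzkinWalks_mul hs ha hc hn, card_motzkinWalks hs,
    mul_div_mul_left _ _ (pow_pos (growthRate_pos s) n).ne']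

lemma sigmaConst_bounds {s : ℕ} (hs : 2 ≤ s) : 1 / 4 < sigmaConst s ∧ sigmaConst s < 1 / 2 := by
  have h : 1 < Real.sqrt s := by
    rw [Real.lt_sqrt zero_le_one]
    have : (2 : ℝ) ≤ s := by exact_mod_cast hs
    linarith
  rw [sigmaConst, div_lt_div_iff₀ (by norm_num) (by positivity),
    div_lt_div_iff₀ (by positivity) (by norm_num)]
  constructor <;> linarith

lemma errorScale_le_of_le {a t n : ℕ} (h : n + 1 ≤ a * (t + 1)) :
    errorScale t ≤ a ^ 3 * errorScale n := by
  have ha1 : 1 ≤ a := by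
    rcases Nat.eq_zero_or_pos a with rfl | h0
    · omega
    · exact h0
  have ha : (1 : ℝ) ≤ a := by exact_mod_cast ha1
  have h' : (n : ℝ) + 1 ≤ a * (t + 1) := by exact_mod_cast h
  have hq : Real.sqrt ((n : ℝ) + 1) ≤ a * Real.sqrt (t + 1) := by
    rw [Real.sqrt_le_left (by positivity), mul_pow, Real.sq_sqrt (by positivity)]
    nlinarith
  rw [errorScale, errorScale, mul_one_div, div_le_div_iff₀ (by positivity) (by positivity)]
  calc 1 * (((n : ℝ) + 1) ^ 2 * Real.sqrt (n + 1)) ≤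
        1 * ((a * ((t : ℝ) + 1)) ^ 2 * (a * Real.sqrt (t + 1))) := by gcongr
    _ = a ^ 3 * (((t : ℝ) + 1) ^ 2 * Real.sqrt (t + 1)) := by ring

lemma errorScale_antitone {t n : ℕ} (h : t ≤ n) : errorScale n ≤ errorScale t := by
  have := errorScale_le_of_le (a := 1) (t := n) (n := t) (by omega)
  simpa using this

lemma abs_sub_add_le_of_abs_sub_succ_le {p : ℕ → ℝ} {C : ℝ} (hC : 0 ≤ C)
    (hp : ∀ n, |p n - p (n + 1)| ≤ C * errorScale n) (t r : ℕ) :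
    |p t - p (t + r)| ≤ r * (C * errorScale t) := by
  induction r with
  | zero => simp
  | succ r ih =>
    have h1 := hp (t + r)
    have h2 := mul_le_mul_of_nonneg_left (errorScale_antitone (Nat.le_add_right t r)) hC
    have h3 := abs_sub_le (p t) (p (t + r)) (p (t + (r + 1)))
    push_cast
    rw [← add_assoc] at h3 ⊢
    linarith

/-- A positive sequence with the asymptotics `c (n + 1) ^ (-3 / 2)` is bounded below
accordingly. -/
lemma exists_errorScale_le_mul {p : ℕ → ℝ} {c C : ℝ} (hc : 0 < c) (hp : ∀ n, 0 < p n)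
    (h : ∀ n : ℕ, |p n - c * (1 / (((n : ℝ) + 1) * Real.sqrt (n + 1)))| ≤ C * errorScale n) :
    ∃ B, 0 < B ∧ ∀ n : ℕ, ((n : ℝ) + 1) * errorScale n ≤ B * p n := by
  set u : ℕ → ℝ := fun n => p n * (((n : ℝ) + 1) * Real.sqrt (n + 1)) with hu
  have hw : ∀ n : ℕ, 0 < ((n : ℝ) + 1) * Real.sqrt (n + 1) := fun n => by positivity
  have hupos : ∀ n, 0 < u n := fun n => mul_pos (hp n) (hw n)
  have hub : ∀ n : ℕ, |u n - c| ≤ C * (1 / ((n : ℝ) + 1)) := by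
    intro n
    have e : u n - c = (p n - c * (1 / (((n : ℝ) + 1) * Real.sqrt (n + 1)))) *
        (((n : ℝ) + 1) * Real.sqrt (n + 1)) := by
      have := (hw n).ne'
      rw [hu]
      field_simp
    rw [e, abs_mul, abs_of_pos (hw n)]
    refine (mul_le_mul_of_nonneg_right (h n) (hw n).le).trans (le_of_eq ?_)
    rw [errorScale]
    have := (hw n).ne'
    have : Real.sqrt ((n : ℝ) + 1) ≠ 0 := by positivity
    field_simp
  have hlim : Filter.Tendsto u Filter.atTop (nhds c) := by
    rw [tendsto_iff_dist_tendsto_zero]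
    refine squeeze_zero (fun _ => dist_nonneg) (fun n => hub n) ?_
    simpa using tendsto_one_div_add_atTop_nhds_zero_nat.const_mul C
  -- The normalized sequence has a positive limit, so its inverses converge and are bounded.
  obtain ⟨B, hB⟩ := (hlim.inv₀ hc.ne').bddAbove_range
  refine ⟨B, lt_of_lt_of_le (inv_pos.2 (hupos 0)) (hB ⟨0, rfl⟩), fun n => ?_⟩
  have h1 : (u n)⁻¹ ≤ B := hB ⟨n, rfl⟩
  have h2 : 1 ≤ B * u n := by rwa [inv_le_iff_one_le_mul₀ (hupos n)] at h1
  have h3 : ((n : ℝ) + 1) * errorScale n = 1 / (((n : ℝ) + 1) * Real.sqrt (n + 1)) := by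
    rw [errorScale]
    field_simp
  rw [h3, div_le_iff₀ (hw n), mul_assoc]
  exact h2

/-- Telescoping over k + 2 decrements loses a factor k + 2, which p k = O(1/(k + 1)) absorbs; hence
the uniformity in the distance. -/
lemma abs_returnProb_ratio_le {p : ℕ → ℝ} {c C : ℝ} (hc : 0 < c) (hC : 0 < C)
    (hp : ∀ n, 0 < p n)
    (h1 : ∀ n : ℕ, |p n - c * (1 / (((n : ℝ) + 1) * Real.sqrt (n + 1)))| ≤ C * errorScale n)
    (h2 : ∀ n, |p n - p (n + 1)| ≤ C * errorScale n) (k t : ℕ) :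
    p k * |p t - p (t + (k + 2))| ≤ 2 * (c + C) * C * errorScale t := by
  have hx : (1 : ℝ) ≤ k + 1 := by linarith [k.cast_nonneg (α := ℝ)]
  have hq : 1 ≤ Real.sqrt ((k : ℝ) + 1) := Real.one_le_sqrt.2 hx
  have hpk : p k * (k + 1) ≤ c + C := by
    have h3 := (abs_le.1 (h1 k)).2
    have h4 : 1 / (((k : ℝ) + 1) * Real.sqrt (k + 1)) ≤ 1 / ((k : ℝ) + 1) := by
      gcongr
      nlinarith
    have h5 : errorScale k ≤ 1 / ((k : ℝ) + 1) := by
      rw [errorScale]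
      gcongr
      nlinarith
    have h6 : p k ≤ (c + C) * (1 / ((k : ℝ) + 1)) := by nlinarith
    rwa [mul_one_div, le_div_iff₀ (by positivity)] at h6
  have hE := errorScale_pos t
  have hd := abs_sub_add_le_of_abs_sub_succ_le hC.le h2 t (k + 2)
  push_cast at hd
  calc p k * |p t - p (t + (k + 2))| ≤ p k * (((k : ℝ) + 2) * (C * errorScale t)) :=
        mul_le_mul_of_nonneg_left hd (hp k).le
    _ ≤ p k * ((2 * ((k : ℝ) + 1)) * (C * errorScale t)) := by
        have := hp k
        gcongr
        linarith
    _ = 2 * (p k * (k + 1)) * (C * errorScale t) := by ring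
    _ ≤ 2 * (c + C) * (C * errorScale t) := by gcongr
    _ = _ := by ring

lemma sq_mul_returnConst {σ : ℝ} (h0 : 0 < σ) :
    σ ^ 2 * returnConst σ = Real.sqrt (σ / Real.pi) / 2 := by
  have hq : 0 < Real.sqrt σ := Real.sqrt_pos.2 h0
  have hπ : 0 < Real.sqrt Real.pi := Real.sqrt_pos.2 Real.pi_pos
  rw [returnConst, Real.sqrt_div h0.le]
  field_simp
  rw [Real.sq_sqrt h0.le]

lemma rpow_neg_three_halves (k : ℕ) :
    ((k + 1 : ℕ) : ℝ) ^ (-(3 / 2) : ℝ) = 1 / (((k : ℝ) + 1) * Real.sqrt (k + 1)) := by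
  have hx : (0 : ℝ) < k + 1 := by positivity
  push_cast
  rw [Real.rpow_neg hx.le, show (3 / 2 : ℝ) = 1 + 1 / 2 by norm_num, Real.rpow_add hx,
    Real.rpow_one, ← Real.sqrt_eq_rpow, one_div]

lemma rpow_neg_five_halves (k : ℕ) :
    ((k + 1 : ℕ) : ℝ) ^ (-(5 / 2) : ℝ) = errorScale k := by
  have hx : (0 : ℝ) < k + 1 := by positivity
  push_cast
  rw [Real.rpow_neg hx.le, show (5 / 2 : ℝ) = (2 : ℕ) + 1 / 2 by norm_num, Real.rpow_add hx,
    Real.rpow_natCast, ← Real.sqrt_eq_rpow, errorScale, one_div]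

theorem theorem5 (s : ℕ) (hs : 2 ≤ s) :
    ∃ (g : ℕ → ℝ) (C : ℝ),
      (∀ L : ℕ, 1 ≤ L →
        |g L - (-(1 / 24) * Real.sqrt (sigmaConst s / Real.pi) * ((s : ℝ) ^ 2 - 1) *
            (L : ℝ) ^ (-(3 / 2) : ℝ))| ≤ C * (L : ℝ) ^ (-(5 / 2) : ℝ)) ∧
      (∀ (n L : ℕ) (i j : Fin n), 1 ≤ L → L ^ 2 ≤ n →
        (i : ℕ) + 1 = (n - L) / 2 → (j : ℕ) + 1 = (n + L) / 2 →
        ‖corrZZ s n i j - (g L : ℂ)‖ ≤ C / (n : ℝ)) := by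
  have hs0 : 0 < s := by omega
  obtain ⟨hσ1, hσ2⟩ := sigmaConst_bounds hs
  have hp := returnProb_sigmaConst_pos hs0
  set σ := sigmaConst s with hσdef
  have hσ : 0 < σ := by linarith
  obtain ⟨C, hC, hCp⟩ := exists_abs_returnProb_sub_le hσ1 hσ2
  have h1 := fun n => (hCp n).1
  have h2 := fun n => (hCp n).2
  have hc : 0 < returnConst σ := by
    unfold returnConst
    have := Real.pi_pos
    positivity
  set c := returnConst σ with hcdef
  obtain ⟨B, hB, hBp⟩ := exists_errorScale_le_mul hc hp h1
  have hγ : 0 ≤ ((s : ℝ) ^ 2 - 1) / 12 * σ ^ 2 := by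
    have : (2 : ℝ) ≤ s := by exact_mod_cast hs
    have : 0 ≤ (s : ℝ) ^ 2 - 1 := by nlinarith
    positivity
  set γ := ((s : ℝ) ^ 2 - 1) / 12 * σ ^ 2 with hγdef
  set μ := (meanColour s * σ) ^ 2 with hμdef
  have hμ : 0 ≤ μ := sq_nonneg _
  set D := (μ * (2 / σ * (2 * C)) + γ * (2 * (c + C) * C)) * 7 ^ 3 with hD
  have hD0 : 0 ≤ D := by positivity
  -- Sites at distance L enclose L - 1 steps. The factor 7 ^ 3 in D comes from comparing
  -- `errorScale` at times of order n with its value at n.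
  refine ⟨fun L => -γ * returnProb σ (L - 1), γ * C + D * B, fun L hL => ?_, ?_⟩
  · obtain ⟨k, rfl⟩ : ∃ k, L = k + 1 := ⟨L - 1, by omega⟩
    have e : -γ * returnProb σ (k + 1 - 1) - (-(1 / 24) * Real.sqrt (σ / Real.pi) *
        ((s : ℝ) ^ 2 - 1) * ((k + 1 : ℕ) : ℝ) ^ (-(3 / 2) : ℝ)) =
        -γ * (returnProb σ k - c * (1 / (((k : ℝ) + 1) * Real.sqrt (k + 1)))) := by
      have h3 : Real.sqrt (σ / Real.pi) = 2 * (σ ^ 2 * c) := by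
        rw [hcdef, sq_mul_returnConst hσ]
        ring
      rw [rpow_neg_three_halves, h3, hγdef, Nat.add_sub_cancel]
      ring
    rw [e, abs_mul, abs_neg, abs_of_nonneg hγ, rpow_neg_five_halves]
    have hE := errorScale_pos k
    have := mul_le_mul_of_nonneg_left (h1 k) hγ
    have : 0 ≤ D * B * errorScale k := by positivity
    linarith
  · intro n L i j hL hLn hi hj
    obtain ⟨k, rfl⟩ : ∃ k, L = k + 1 := ⟨L - 1, by omega⟩
    -- This consequence of L² ≤ n keeps both ends of the chain at a distance of order n from the
    -- marked sites. For L = 1 it uses that the left site exists.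
    have h2L : 2 * (k + 1) ≤ n := by
      rcases k with _ | k
      · omega
      · nlinarith
    obtain ⟨m, hm⟩ : ∃ m, n = (i : ℕ) + (k + (m + 1) + 1) :=
      ⟨n - (i + k + 2), by omega⟩
    rw [corrZZ_eq_returnProb hs0 (i := i) (k := k) (m := m) rfl (by omega) hm, ← hσdef,
      ← hμdef, ← hγdef, ← Complex.ofReal_sub, Complex.norm_real, Real.norm_eq_abs]
    beta_reduce
    rw [Nat.add_sub_cancel]
    have hn : n = (i : ℕ) + m + (k + 2) := by omega
    have hX := abs_direction_correlation_le hσ hσ2.le i k m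
    set X := (killedStep σ)^[i] (shiftDiff ((killedStep σ)^[k]
      (shiftDiff ((killedStep σ)^[m] zeroHeight)))) 0
    have hR := abs_returnProb_ratio_le hc hC hp h1 h2 k (i + m)
    rw [← hn] at hR
    have hE : ∀ t : ℕ, 2 * (i : ℕ) ≤ t → errorScale t ≤ 7 ^ 3 * errorScale n := fun t ht => by
      -- From 2L ≤ n and the floor in `hi`, n ≤ 4i + 6, so n + 1 ≤ 2t + 7 ≤ 7(t + 1).
      have := errorScale_le_of_le (a := 7) (t := t) (n := n) (by omega)
      exact_mod_cast this
    have hX' : |X| ≤ 2 / σ * (2 * C) * (7 ^ 3 * errorScale n) := by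
      refine hX.trans ?_
      rw [mul_assoc]
      refine mul_le_mul_of_nonneg_left ?_ (by positivity)
      have a1 := (le_abs_self _).trans (h2 (2 * i))
      have a2 := (le_abs_self _).trans (h2 (2 * m))
      have a3 := mul_le_mul_of_nonneg_left (hE (2 * i) le_rfl) hC.le
      have a4 := mul_le_mul_of_nonneg_left (hE (2 * m) (by omega)) hC.le
      linarith
    have hR' : returnProb σ k * |returnProb σ (i + m) - returnProb σ n| ≤
        2 * (c + C) * C * (7 ^ 3 * errorScale n) :=
      hR.trans (mul_le_mul_of_nonneg_left (hE (i + m) (by omega)) (by positivity))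
    have hpn := hp n
    have e : (μ * X - γ * (returnProb σ k * returnProb σ (i + m))) / returnProb σ n -
        -γ * returnProb σ k = (μ * X - γ * (returnProb σ k *
          (returnProb σ (i + m) - returnProb σ n))) / returnProb σ n := by
      field_simp
      ring
    have hnum : |μ * X - γ * (returnProb σ k * (returnProb σ (i + m) - returnProb σ n))| ≤
        D * errorScale n := by
      refine (abs_sub _ _).trans ?_
      rw [abs_mul μ, abs_mul γ, abs_mul (returnProb σ k), abs_of_nonneg hμ, abs_of_nonneg hγ, abs_of_pos (hp k)]
      have := mul_le_mul_of_nonneg_left hX' hμ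
      have := mul_le_mul_of_nonneg_left hR' hγ
      rw [hD]
      linarith
    have hn0 : (0 : ℝ) < n := by exact_mod_cast (by omega : 0 < n)
    have hEn := errorScale_pos n
    rw [e, abs_div, abs_of_pos hpn, div_le_div_iff₀ hpn hn0]
    calc _ ≤ D * errorScale n * ((n : ℝ) + 1) :=
          mul_le_mul hnum (by linarith) hn0.le (by positivity)
      _ = D * (((n : ℝ) + 1) * errorScale n) := by ring
      _ ≤ D * (B * returnProb σ n) := mul_le_mul_of_nonneg_left (hBp n) hD0
      _ ≤ (γ * C + D * B) * returnProb σ n := by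
          have : 0 ≤ γ * C * returnProb σ n := by positivity
          linarith
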